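/- Let $(M^m,g_1)$ be a Riemannian manifold, $(N^n,g_2,J)$ a Kähler manifold (i.e. $J$ is a smooth $(1,1)$-tensor with $J^2=-I$, $g_2(J\cdot,J\cdot)=g_2$ and $\nabla^N J=0$), and $F:M\to N$ a smooth map. Assume: (a) $F$ is a Riemannian map: $g_2(F_*X,F_*Y)=g_1(X,Y)$ for all $p\in M$ and $X,Y\in(\ker F_{*p})^\perp$. (b) $F$ is Lagrangian: for every $p\in M$, $J(\operatorname{range}F_{*p})\subseteq(\operatorname{range}F_{*p})^\perp$, and the orthogonal complement $\mu_p$ of $J(\operatorname{range}F_{*p})$ in $(\operatorname{range}F_{*p})^\perp$ is $0$. (c) $F$ is Clairaut with $\tilde s=e^g$ for a smooth function $g:N\to\mathbb R$: every $p\in M$ has an open neighbourhood $U$ for which there are an open set $W\subseteq N$ containing $F(U)$ and a smooth distribution $D$ on $W$ extending $\operatorname{range}F_*$ (i.e. $D_{F(q)}=\operatorname{range}F_{*q}$ for $q\in U$), such that for every geodesic $\beta:(a,b)\to N$ of $N$ with values in $W$ the function $t\mapsto \tilde s(\beta(t))\sin\omega(t)$ is constant, where $\omega(t)$ is the angle between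 $\dot\beta(t)$ and its component $V(t)$ in $D^\perp$ (with $\omega(t)=\pi/2$ if $V(t)=0$). (d) $\dim(\operatorname{range}F_{*p})>1$ for every $p\in M$. Let $H$ be the mean curvature vector field of the distribution $\ker F_*$, i.e. $H=\frac1r\sum_{i=1}^r\bigl(\nabla^M_{U_i}U_i\bigr)^{\perp}$ for a local orthonormal frame $U_1,\dots,U_r$ of $\ker F_*$, where $r=\dim\ker F_*$ and $\perp$ denotes the component in $(\ker F_*)^\perp$ (and $H=0$ if $r=0$). Then $F$ is harmonic, i.e. its tension field $\tau(F)=\operatorname{trace}(\nabla F_*)$ vanishes identically, if and only if $H$ is constant, i.e. $\nabla^M H=0$. -/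

import Mathlib

open Bundle
open scoped Manifold ContDiff

noncomputable section

namespace RiemannianMap

/-! ### Riemannian geometry on a manifold `M` -/

section Metric

variable {E : Type*} [NormedAddCommGroup E] [NormedSpace ℝ E] [FiniteDimensional ℝ E]
  {H : Type*} [TopologicalSpace H] (I : ModelWithCorners ℝ E H)
  {M : Type*} [TopologicalSpace M] [ChartedSpace H M]

instance instFiniteDimensionalTangentSpace (x : M) : FiniteDimensional ℝ (TangentSpace I x) :=
  inferInstanceAs (FiniteDimensional ℝ E)

variable [IsManifold I 1 M]

/-- A vector field on `M`, seen as a map into the tangent bundle, is smooth at `x`. -/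
def SmoothFieldAt (X : Π x : M, TangentSpace I x) (x : M) : Prop :=
  ContMDiffAt I I.tangent ∞ (fun y ↦ (⟨y, X y⟩ : TangentBundle I M)) x

/-- The family of endomorphisms `A y : T_y M → T_y M` is smooth on `W`, as a section of the bundle
`End(TM)`. -/
def SmoothEndOn (A : Π y : M, TangentSpace I y →L[ℝ] TangentSpace I y) (W : Set M) : Prop :=
  ContMDiffOn I (I.prod 𝓘(ℝ, E →L[ℝ] E)) ∞
    (fun y ↦ Bundle.TotalSpace.mk' (E →L[ℝ] E)
      (E := fun y : M ↦ TangentSpace I y →L[ℝ] TangentSpace I y) y (A y)) W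

variable [RiemannianBundle (fun x : M ↦ TangentSpace I x)]

/-- Half of the right-hand side of the Koszul formula at `x`, i.e. the number `⟨∇_X Y, Z⟩(x)`. -/
def koszul (X Y Z : Π x : M, TangentSpace I x) (x : M) : ℝ :=
  (mvfderiv I (fun y ↦ inner ℝ (Y y) (Z y)) x (X x)
    + mvfderiv I (fun y ↦ inner ℝ (X y) (Z y)) x (Y x)
    - mvfderiv I (fun y ↦ inner ℝ (X y) (Y y)) x (Z x)
    + inner ℝ (VectorField.mlieBracket I X Y x) (Z x)
    - inner ℝ (VectorField.mlieBracket I X Z x) (Y x)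
    - inner ℝ (VectorField.mlieBracket I Y Z x) (X x)) / 2

/-- The Levi-Civita connection: `leviCivita I Y x v` is `∇_v Y` for a vector field `Y` differentiable
at `x` and `v ∈ T_x M`. Its components in an orthonormal basis of `T_x M` are given by the Koszul
formula, in which `v` and the basis vectors are extended to vector fields that are smooth near `x`
(the formula depends only on the values of these extensions at `x`). -/
def leviCivita (Y : Π x : M, TangentSpace I x) (x : M) (v : TangentSpace I x) :
    TangentSpace I x :=
  ∑ i, koszul I (FiberBundle.extend E v) Y
      (FiberBundle.extend E (stdOrthonormalBasis ℝ (TangentSpace I x) i)) x •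
    stdOrthonormalBasis ℝ (TangentSpace I x) i

/-- A vector field is parallel (constant) if it is smooth and its covariant derivative vanishes. -/
def IsParallel (X : Π x : M, TangentSpace I x) : Prop :=
  (∀ x, SmoothFieldAt I X x) ∧ ∀ (x : M) (v : TangentSpace I x), leviCivita I X x v = 0

/-- The covariant derivative along a map. For a map `f : B → M` and a vector field `s` along `f`
(`s q ∈ T_{f q} M`), `covAlong I I' f s p u` is `∇^f_u s`, the pullback of the Levi-Civita
connection. If `e₁, …, e_k` is the frame of `TM` near `f p` given by the trivialization of `TM`
at `f p` and `s = ∑ sⁱ (eᵢ ∘ f)`, then `∇^f_u s = ∑ dsⁱ(u) eᵢ + ∑ sⁱ ∇_{df(u)} eᵢ`. -/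
def covAlong {E' : Type*} [NormedAddCommGroup E'] [NormedSpace ℝ E']
    {H' : Type*} [TopologicalSpace H'] (I' : ModelWithCorners ℝ E' H')
    {B : Type*} [TopologicalSpace B] [ChartedSpace H' B]
    (f : B → M) (s : Π q : B, TangentSpace I (f q)) (p : B) (u : TangentSpace I' p) :
    TangentSpace I (f p) :=
  (trivializationAt E (TangentSpace I : M → Type _) (f p)).symm (f p)
      (mvfderiv I' (fun q ↦ (trivializationAt E (TangentSpace I : M → Type _) (f p)
        ⟨f q, s q⟩).2) p u)
    + leviCivita I (FiberBundle.extend E (s p)) (f p) (mfderiv I' I f p u)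

/-- The velocity of a curve. -/
def velocity (β : ℝ → M) (t : ℝ) : TangentSpace I (β t) :=
  mfderiv 𝓘(ℝ, ℝ) I β t (1 : ℝ)

/-- `β` is a geodesic on the open interval `(a, b)`. -/
def IsGeodesicOn (β : ℝ → M) (a b : ℝ) : Prop :=
  ContMDiffOn 𝓘(ℝ, ℝ) I ∞ β (Set.Ioo a b) ∧
    ∀ t ∈ Set.Ioo a b, covAlong I 𝓘(ℝ, ℝ) β (velocity I β) t (1 : ℝ) = 0

/-- The distribution `D` is smooth on `W`: the orthogonal projection onto it is. -/
def IsSmoothDistributionOn (D : Π y : M, Submodule ℝ (TangentSpace I y)) (W : Set M) : Prop :=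
  SmoothEndOn I (fun y ↦ (D y).starProjection) W

/-- The second fundamental form of a distribution `D` on `M`: for `u, v ∈ D_x` it is the component
orthogonal to `D` of `∇_u V`, where `V` is a section of `D` with `V x = v`. -/
def distributionSFF (D : Π y : M, Submodule ℝ (TangentSpace I y)) (x : M)
    (u v : TangentSpace I x) : TangentSpace I x :=
  (D x)ᗮ.starProjection
    (leviCivita I (fun y ↦ (D y).starProjection (FiberBundle.extend E v y)) x u)

/-- The mean curvature vector field of a distribution: the trace of its second fundamental form
divided by its rank (and `0` for the distribution of rank `0`). -/
def meanCurvature (D : Π y : M, Submodule ℝ (TangentSpace I y)) (x : M) : TangentSpace I x :=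
  (Module.finrank ℝ (D x) : ℝ)⁻¹ •
    ∑ i, distributionSFF I D x (stdOrthonormalBasis ℝ (D x) i) (stdOrthonormalBasis ℝ (D x) i)

/-- `(M, g, J)` is a Kähler manifold: `J` is a smooth orthogonal almost complex structure that is
parallel with respect to the Levi-Civita connection, `(∇_v J) Y = ∇_v (J Y) - J ∇_v Y = 0`. -/
structure IsKahler (J : Π y : M, TangentSpace I y →L[ℝ] TangentSpace I y) : Prop where
  smooth : SmoothEndOn I J Set.univ
  sq : ∀ (y : M) (v : TangentSpace I y), J y (J y v) = -v
  isometry : ∀ (y : M) (v w : TangentSpace I y), inner ℝ (J y v) (J y w) = inner ℝ v w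
  parallel : ∀ (Y : Π y : M, TangentSpace I y) (y : M) (v : TangentSpace I y),
    SmoothFieldAt I Y y → leviCivita I (fun z ↦ J z (Y z)) y v = J y (leviCivita I Y y v)

end Metric

/-! ### Riemannian maps `F : (M, g₁) → (N, g₂)` -/

section Maps

variable {E : Type*} [NormedAddCommGroup E] [NormedSpace ℝ E] [FiniteDimensional ℝ E]
  {H : Type*} [TopologicalSpace H] (I : ModelWithCorners ℝ E H)
  {M : Type*} [TopologicalSpace M] [ChartedSpace H M]
  {E' : Type*} [NormedAddCommGroup E'] [NormedSpace ℝ E'] [FiniteDimensional ℝ E']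
  {H' : Type*} [TopologicalSpace H'] (I' : ModelWithCorners ℝ E' H')
  {N : Type*} [TopologicalSpace N] [ChartedSpace H' N]

/-- The vertical distribution `ker F_*` on `M`. -/
def kerD (F : M → N) (p : M) : Submodule ℝ (TangentSpace I p) :=
  LinearMap.ker (mfderiv I I' F p).toLinearMap

/-- The space `range F_{*p} ⊆ T_{F p} N`. -/
def rangeD (F : M → N) (p : M) : Submodule ℝ (TangentSpace I' (F p)) :=
  LinearMap.range (mfderiv I I' F p).toLinearMap

variable [RiemannianBundle (fun x : M ↦ TangentSpace I x)]
  [RiemannianBundle (fun y : N ↦ TangentSpace I' y)]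

/-- `F` is a Riemannian map: it is smooth, and each `F_{*p}` is isometric on `(ker F_{*p})ᗮ`. -/
structure IsRiemannianMap (F : M → N) : Prop where
  smooth : ContMDiff I I' ∞ F
  isometry : ∀ p, ∀ u ∈ (kerD I I' F p)ᗮ, ∀ v ∈ (kerD I I' F p)ᗮ,
    inner ℝ (mfderiv I I' F p u) (mfderiv I I' F p v) = inner ℝ u v

/-- `J (range F_*)` is contained in `(range F_*)ᗮ`, and the orthogonal complement `μ` of
`J (range F_*)` in `(range F_*)ᗮ` vanishes. -/
structure IsLagrangian (F : M → N)
    (J : Π y : N, TangentSpace I' y →L[ℝ] TangentSpace I' y) : Prop where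
  antiInvariant : ∀ p, (rangeD I I' F p).map (J (F p)).toLinearMap ≤ (rangeD I I' F p)ᗮ
  mu_eq_bot : ∀ p,
    (rangeD I I' F p)ᗮ ⊓ ((rangeD I I' F p).map (J (F p)).toLinearMap)ᗮ = ⊥

variable [IsManifold I 1 M] [IsManifold I' 1 N]

/-- `F` satisfies Clairaut's relation with the function `s : N → ℝ`. The relation is about the
components of the velocity of geodesics of `N` in `range F_*` and in `(range F_*)ᗮ`; since
`range F_*` itself is given only along `F`, it is extended, near each point of `M`, to a smooth
distribution `D` on an open subset `W` of `N`. For every geodesic `β` in `W`,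
`s (β t) * sin (ω t)` is constant, where `ω t` is the angle between `β' t` and its component
in `Dᗮ` (a right angle if this component is `0`). -/
def IsClairautWith (F : M → N) (s : N → ℝ) : Prop :=
  (∀ y, 0 < s y) ∧
  ∀ p : M, ∃ U : Set M, IsOpen U ∧ p ∈ U ∧ ∃ W : Set N, IsOpen W ∧
    ∃ D : Π y : N, Submodule ℝ (TangentSpace I' y), IsSmoothDistributionOn I' D W ∧
      (∀ q ∈ U, F q ∈ W ∧ D (F q) = rangeD I I' F q) ∧
      ∀ (β : ℝ → N) (a b : ℝ), IsGeodesicOn I' β a b → (∀ t ∈ Set.Ioo a b, β t ∈ W) →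
        ∃ c : ℝ, ∀ t ∈ Set.Ioo a b,
          s (β t) * Real.sin (InnerProductGeometry.angle (velocity I' β t)
            ((D (β t))ᗮ.starProjection (velocity I' β t))) = c

/-- The second fundamental form of `F`:
`(∇F_*)(u, v) = ∇^F_u (F_* V) - F_* (∇_u V)` for a vector field `V` extending `v`. -/
def secondFundamentalForm (F : M → N) (p : M) (u v : TangentSpace I p) :
    TangentSpace I' (F p) :=
  covAlong I' I F (fun q ↦ mfderiv I I' F q (FiberBundle.extend E v q)) p u
    - mfderiv I I' F p (leviCivita I (FiberBundle.extend E v) p u)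

/-- The tension field `τ(F) = trace ∇F_*`. -/
def tensionField (F : M → N) (p : M) : TangentSpace I' (F p) :=
  ∑ i, secondFundamentalForm I I' F p (stdOrthonormalBasis ℝ (TangentSpace I p) i)
    (stdOrthonormalBasis ℝ (TangentSpace I p) i)

/-- `F` is harmonic: its tension field vanishes. -/
def IsHarmonic (F : M → N) : Prop :=
  ContMDiff I I' ∞ F ∧ ∀ p, tensionField I I' F p = 0

end Maps

end RiemannianMap

end

namespace RiemannianMap

open VectorField Filter
open scoped Topology

set_option linter.unusedSectionVars false

section LeviCivita

variable {E : Type*} [NormedAddCommGroup E] [NormedSpace ℝ E] [FiniteDimensional ℝ E]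
  {H : Type*} [TopologicalSpace H] {I : ModelWithCorners ℝ E H}
  {M : Type*} [TopologicalSpace M] [ChartedSpace H M] [IsManifold I ∞ M]
  [RiemannianBundle (fun x : M ↦ TangentSpace I x)]
  [IsContMDiffRiemannianBundle I ∞ E (fun x : M ↦ TangentSpace I x)]
  {X X' Y Y' Z : Π x : M, TangentSpace I x} {f : M → ℝ} {x : M}

theorem mdifferentiableAt_inner (hX : MDiffAt (T% X) x) (hY : MDiffAt (T% Y) x) :
    MDiffAt (fun y ↦ inner ℝ (X y) (Y y)) x :=
  MDifferentiableAt.inner_bundle (b := fun y : M ↦ y) hX hY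

theorem koszul_add_left (hX : MDiffAt (T% X) x) (hX' : MDiffAt (T% X') x)
    (hY : MDiffAt (T% Y) x) (hZ : MDiffAt (T% Z) x) :
    koszul I (X + X') Y Z x = koszul I X Y Z x + koszul I X' Y Z x := by
  have : CompleteSpace E := FiniteDimensional.complete ℝ E
  simp only [koszul, Pi.add_apply, inner_add_left, inner_add_right, map_add,
    mlieBracket_add_left hX hX',
    mvfderiv_fun_add (mdifferentiableAt_inner hX hZ) (mdifferentiableAt_inner hX' hZ),
    mvfderiv_fun_add (mdifferentiableAt_inner hX hY) (mdifferentiableAt_inner hX' hY),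
    _root_.add_apply]
  ring

theorem koszul_smul_left (hf : MDiffAt f x) (hX : MDiffAt (T% X) x)
    (hY : MDiffAt (T% Y) x) (hZ : MDiffAt (T% Z) x) :
    koszul I (f • X) Y Z x = f x * koszul I X Y Z x := by
  have : CompleteSpace E := FiniteDimensional.complete ℝ E
  simp only [koszul, Pi.smul_apply', inner_smul_left, inner_smul_right, map_smul,
    mlieBracket_smul_left hf hX, inner_add_left, RCLike.conj_to_real, smul_eq_mul,
    mvfderiv_fun_mul hf (mdifferentiableAt_inner hX hZ),
    mvfderiv_fun_mul hf (mdifferentiableAt_inner hX hY),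
    _root_.add_apply, _root_.smul_apply]
  ring

theorem koszul_add_right (hX : MDiffAt (T% X) x) (hX' : MDiffAt (T% X') x)
    (hY : MDiffAt (T% Y) x) (hZ : MDiffAt (T% Z) x) :
    koszul I Z Y (X + X') x = koszul I Z Y X x + koszul I Z Y X' x := by
  have : CompleteSpace E := FiniteDimensional.complete ℝ E
  simp only [koszul, Pi.add_apply, inner_add_left, inner_add_right, map_add,
    mlieBracket_add_right hX hX',
    mvfderiv_fun_add (mdifferentiableAt_inner hY hX) (mdifferentiableAt_inner hY hX'),
    mvfderiv_fun_add (mdifferentiableAt_inner hZ hX) (mdifferentiableAt_inner hZ hX'),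
    _root_.add_apply]
  ring

theorem koszul_smul_right (hf : MDiffAt f x) (hX : MDiffAt (T% X) x)
    (hY : MDiffAt (T% Y) x) (hZ : MDiffAt (T% Z) x) :
    koszul I Z Y (f • X) x = f x * koszul I Z Y X x := by
  have : CompleteSpace E := FiniteDimensional.complete ℝ E
  simp only [koszul, Pi.smul_apply', inner_smul_left, inner_smul_right, map_smul,
    mlieBracket_smul_right hf hX, inner_add_left, RCLike.conj_to_real, smul_eq_mul,
    mvfderiv_fun_mul hf (mdifferentiableAt_inner hY hX),
    mvfderiv_fun_mul hf (mdifferentiableAt_inner hZ hX),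
    _root_.add_apply, _root_.smul_apply]
  rw [real_inner_comm (Z x) (X x), real_inner_comm (Y x) (X x)]
  ring

theorem koszul_add_middle (hX : MDiffAt (T% X) x) (hX' : MDiffAt (T% X') x)
    (hY : MDiffAt (T% Y) x) (hZ : MDiffAt (T% Z) x) :
    koszul I Y (X + X') Z x = koszul I Y X Z x + koszul I Y X' Z x := by
  have : CompleteSpace E := FiniteDimensional.complete ℝ E
  simp only [koszul, Pi.add_apply, inner_add_left, inner_add_right, map_add,
    mlieBracket_add_right hX hX', mlieBracket_add_left hX hX',
    mvfderiv_fun_add (mdifferentiableAt_inner hX hZ) (mdifferentiableAt_inner hX' hZ),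
    mvfderiv_fun_add (mdifferentiableAt_inner hY hX) (mdifferentiableAt_inner hY hX'),
    _root_.add_apply]
  ring

theorem koszul_smul_middle (hf : MDiffAt f x) (hX : MDiffAt (T% X) x)
    (hY : MDiffAt (T% Y) x) (hZ : MDiffAt (T% Z) x) :
    koszul I Y (f • X) Z x
      = f x * koszul I Y X Z x + mvfderiv I f x (Y x) * inner ℝ (X x) (Z x) := by
  have : CompleteSpace E := FiniteDimensional.complete ℝ E
  simp only [koszul, Pi.smul_apply', inner_smul_left, inner_smul_right, map_smul,
    mlieBracket_smul_right hf hX, mlieBracket_smul_left hf hX, inner_add_left,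
    RCLike.conj_to_real, smul_eq_mul,
    mvfderiv_fun_mul hf (mdifferentiableAt_inner hX hZ),
    mvfderiv_fun_mul hf (mdifferentiableAt_inner hY hX),
    _root_.add_apply, _root_.smul_apply]
  rw [real_inner_comm (Y x) (X x)]
  ring

theorem tensorialAt_koszul_left (hY : MDiffAt (T% Y) x) (hZ : MDiffAt (T% Z) x) :
    TensorialAt I E (fun X ↦ koszul I X Y Z x) x where
  smul hf hX := koszul_smul_left hf hX hY hZ
  add hX hX' := koszul_add_left hX hX' hY hZ

theorem tensorialAt_koszul_right (hX : MDiffAt (T% X) x) (hY : MDiffAt (T% Y) x) :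
    TensorialAt I E (fun Z ↦ koszul I X Y Z x) x where
  smul hf hZ := koszul_smul_right hf hZ hY hX
  add hZ hZ' := koszul_add_right hZ hZ' hY hX

theorem mdifferentiableAt_extend (v : TangentSpace I x) :
    MDiffAt (T% (FiberBundle.extend E v : Π y : M, TangentSpace I y)) x :=
  FiberBundle.mdifferentiableAt_extend I E v

/-- The Levi-Civita connection satisfies the Koszul formula. -/
theorem inner_leviCivita (hX : MDiffAt (T% X) x) (hY : MDiffAt (T% Y) x)
    (hZ : MDiffAt (T% Z) x) :
    inner ℝ (leviCivita I Y x (X x)) (Z x) = koszul I X Y Z x := by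
  have hX0 := mdifferentiableAt_extend (X x)
  have hT := tensorialAt_koszul_right hX0 hY
  have key : ∀ v : TangentSpace I x,
      TensorialAt.mkHom _ x hT v
        = koszul I (FiberBundle.extend E (X x)) Y (FiberBundle.extend E v) x := fun v ↦ rfl
  rw [(tensorialAt_koszul_left hY hZ).pointwise hX hX0 (by simp),
    ← TensorialAt.mkHom_apply hT hZ]
  simp only [leviCivita, ← key]
  conv_rhs => rw [← (stdOrthonormalBasis ℝ (TangentSpace I x)).sum_repr (Z x)]
  simp only [sum_inner, inner_smul_left, map_sum, map_smul, OrthonormalBasis.repr_apply_apply,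
    RCLike.conj_to_real, smul_eq_mul]
  exact Finset.sum_congr rfl fun i _ ↦ mul_comm _ _

theorem inner_leviCivita_extend (hY : MDiffAt (T% Y) x) (v w : TangentSpace I x) :
    inner ℝ (leviCivita I Y x v) w
      = koszul I (FiberBundle.extend E v) Y (FiberBundle.extend E w) x := by
  have := inner_leviCivita (mdifferentiableAt_extend v) hY (mdifferentiableAt_extend w)
  simpa using this

theorem leviCivita_add (hY : MDiffAt (T% Y) x) (hY' : MDiffAt (T% Y') x)
    (v : TangentSpace I x) :
    leviCivita I (Y + Y') x v = leviCivita I Y x v + leviCivita I Y' x v := by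
  refine ext_inner_right ℝ fun w ↦ ?_
  rw [inner_add_left, inner_leviCivita_extend (mdifferentiableAt_add_section hY hY'),
    inner_leviCivita_extend hY, inner_leviCivita_extend hY']
  exact koszul_add_middle hY hY' (mdifferentiableAt_extend v) (mdifferentiableAt_extend w)

theorem leviCivita_smul (hf : MDiffAt f x) (hY : MDiffAt (T% Y) x) (v : TangentSpace I x) :
    leviCivita I (f • Y) x v = f x • leviCivita I Y x v + mvfderiv I f x v • Y x := by
  refine ext_inner_right ℝ fun w ↦ ?_
  rw [inner_add_left, inner_leviCivita_extend (hf.smul_section hY), inner_smul_left,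
    inner_smul_left, inner_leviCivita_extend hY]
  simpa using koszul_smul_middle hf hY (mdifferentiableAt_extend v) (mdifferentiableAt_extend w)

theorem leviCivita_add_right (hY : MDiffAt (T% Y) x) (v w : TangentSpace I x) :
    leviCivita I Y x (v + w) = leviCivita I Y x v + leviCivita I Y x w := by
  refine ext_inner_right ℝ fun u ↦ ?_
  have hv := mdifferentiableAt_extend v
  have hw := mdifferentiableAt_extend w
  have h := inner_leviCivita (mdifferentiableAt_add_section hv hw) hY (mdifferentiableAt_extend u)
  rw [inner_add_left, inner_leviCivita_extend hY v, inner_leviCivita_extend hY w,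
    ← koszul_add_left hv hw hY (mdifferentiableAt_extend u), ← h]
  simp

theorem leviCivita_smul_right (hY : MDiffAt (T% Y) x) (c : ℝ) (v : TangentSpace I x) :
    leviCivita I Y x (c • v) = c • leviCivita I Y x v := by
  refine ext_inner_right ℝ fun u ↦ ?_
  have hv := mdifferentiableAt_extend v
  have hc : MDiffAt (fun _ : M ↦ c) x := mdifferentiableAt_const
  have h := inner_leviCivita (hc.smul_section hv) hY (mdifferentiableAt_extend u)
  have h2 := koszul_smul_left hc hv hY (mdifferentiableAt_extend u)
  rw [inner_smul_left, inner_leviCivita_extend hY v]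
  simp only [RCLike.conj_to_real]
  rw [← h2]
  simpa using h

/-- The Levi-Civita connection as a map that is linear in the direction. -/
noncomputable def leviCivitaHom (hY : MDiffAt (T% Y) x) : TangentSpace I x →ₗ[ℝ] TangentSpace I x where
  toFun := leviCivita I Y x
  map_add' := leviCivita_add_right hY
  map_smul' := leviCivita_smul_right hY

theorem leviCivita_congr (hY : MDiffAt (T% Y) x) (hY' : MDiffAt (T% Y') x)
    (h : ∀ᶠ y in 𝓝 x, Y y = Y' y) (v : TangentSpace I x) :
    leviCivita I Y x v = leviCivita I Y' x v := by
  classical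
  let ψ : M → ℝ := fun y ↦ if Y y = Y' y then 1 else 0
  have e : ψ • Y = ψ • Y' := by
    funext y
    by_cases hy : Y y = Y' y <;> simp [ψ, hy]
  have hev : ψ =ᶠ[𝓝 x] fun _ ↦ 1 := h.mono fun y hy ↦ by simp [ψ, hy]
  have hψ : MDiffAt ψ x :=
    (mdifferentiableAt_const (c := (1 : ℝ))).congr_of_eventuallyEq hev
  have hψx : ψ x = 1 := hev.self_of_nhds
  have h1 := leviCivita_smul hψ hY v
  have h2 := leviCivita_smul hψ hY' v
  rw [e, h2, hψx, one_smul, one_smul, h.self_of_nhds] at h1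
  exact (add_right_cancel h1).symm

theorem leviCivita_zero (v : TangentSpace I x) :
    leviCivita I (0 : Π y : M, TangentSpace I y) x v = 0 := by
  have h0 : MDiffAt (T% (0 : Π y : M, TangentSpace I y)) x := mdifferentiableAt_zeroSection ..
  simpa using leviCivita_add h0 h0 v

/-- The Levi-Civita connection is compatible with the metric. -/
theorem mvfderiv_inner (hY : MDiffAt (T% Y) x) (hZ : MDiffAt (T% Z) x)
    (v : TangentSpace I x) :
    mvfderiv I (fun y ↦ inner ℝ (Y y) (Z y)) x v
      = inner ℝ (leviCivita I Y x v) (Z x) + inner ℝ (Y x) (leviCivita I Z x v) := by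
  have hX := mdifferentiableAt_extend v
  have h1 := inner_leviCivita hX hY hZ
  have h2 := inner_leviCivita hX hZ hY
  rw [real_inner_comm] at h2
  rw [FiberBundle.extend_apply_self] at h1 h2
  rw [h1, h2]
  set X := (FiberBundle.extend E v : Π y : M, TangentSpace I y)
  have hv : X x = v := FiberBundle.extend_apply_self E v
  have e1 : (fun y ↦ inner ℝ (Z y) (Y y)) = fun y ↦ inner ℝ (Y y) (Z y) :=
    funext fun y ↦ real_inner_comm _ _
  rw [koszul, koszul, e1, mlieBracket_swap_apply (V := Z) (W := Y), hv, inner_neg_left]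
  ring

/-- The Levi-Civita connection is torsion-free. -/
theorem leviCivita_sub_swap (hX : MDiffAt (T% X) x) (hY : MDiffAt (T% Y) x) :
    leviCivita I Y x (X x) - leviCivita I X x (Y x) = mlieBracket I X Y x := by
  refine ext_inner_right ℝ fun w ↦ ?_
  have hZ := mdifferentiableAt_extend w
  have h1 := inner_leviCivita hX hY hZ
  have h2 := inner_leviCivita hY hX hZ
  rw [FiberBundle.extend_apply_self] at h1 h2
  rw [inner_sub_left, h1, h2]
  set Z := (FiberBundle.extend E w : Π y : M, TangentSpace I y)
  have hw : Z x = w := FiberBundle.extend_apply_self E w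
  have e1 : (fun y ↦ inner ℝ (Y y) (X y)) = fun y ↦ inner ℝ (X y) (Y y) :=
    funext fun y ↦ real_inner_comm _ _
  rw [koszul, koszul, e1, mlieBracket_swap_apply (V := Y) (W := X), hw, inner_neg_left]
  ring

end LeviCivita

theorem mvfderiv_congr {E : Type*} [NormedAddCommGroup E] [NormedSpace ℝ E]
    {H : Type*} [TopologicalSpace H] {I : ModelWithCorners ℝ E H}
    {M : Type*} [TopologicalSpace M] [ChartedSpace H M]
    {G : Type*} [NormedAddCommGroup G] [NormedSpace ℝ G] {f g : M → G} {x : M}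
    (h : f =ᶠ[𝓝 x] g) : mvfderiv I f x = mvfderiv I g x := by
  ext v
  have := h.mfderiv_eq (I := I) (I' := 𝓘(ℝ, G))
  exact congrArg (fun L : E →L[ℝ] G ↦ L v) this

theorem mvfderiv_comp_apply' {E : Type*} [NormedAddCommGroup E] [NormedSpace ℝ E]
    {H : Type*} [TopologicalSpace H] {I : ModelWithCorners ℝ E H}
    {M : Type*} [TopologicalSpace M] [ChartedSpace H M]
    {E' : Type*} [NormedAddCommGroup E'] [NormedSpace ℝ E']
    {H' : Type*} [TopologicalSpace H'] {I' : ModelWithCorners ℝ E' H'}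
    {B : Type*} [TopologicalSpace B] [ChartedSpace H' B]
    {G : Type*} [NormedAddCommGroup G] [NormedSpace ℝ G] {f : B → M} {g : M → G} {p : B}
    (hg : MDiffAt g (f p)) (hf : MDiffAt f p) (u : TangentSpace I' p) :
    mvfderiv I' (fun q ↦ g (f q)) p u = mvfderiv I g (f p) (mfderiv I' I f p u) :=
  mfderiv_comp_apply p hg hf u

section Along

variable {E : Type*} [NormedAddCommGroup E] [NormedSpace ℝ E] [FiniteDimensional ℝ E]
  {H : Type*} [TopologicalSpace H] {I : ModelWithCorners ℝ E H}
  {M : Type*} [TopologicalSpace M] [ChartedSpace H M] [IsManifold I ∞ M]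
  [RiemannianBundle (fun x : M ↦ TangentSpace I x)]
  [IsContMDiffRiemannianBundle I ∞ E (fun x : M ↦ TangentSpace I x)]
  {E' : Type*} [NormedAddCommGroup E'] [NormedSpace ℝ E']
  {H' : Type*} [TopologicalSpace H'] {I' : ModelWithCorners ℝ E' H'}
  {B : Type*} [TopologicalSpace B] [ChartedSpace H' B]
  {f : B → M} {s s' : Π q : B, TangentSpace I (f q)} {p : B} {φ : B → ℝ}
  {u : TangentSpace I' p}

variable (I I') in
/-- The vector field `s` along `f` is differentiable at `p`. -/
def MDiffAlongAt (f : B → M) (s : Π q : B, TangentSpace I (f q)) (p : B) : Prop :=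
  MDifferentiableAt I' I.tangent (fun q ↦ (⟨f q, s q⟩ : TangentBundle I M)) p

theorem mdiffAlongAt_iff :
    MDiffAlongAt I I' f s p ↔ MDiffAt f p ∧
      MDifferentiableAt I' 𝓘(ℝ, E) (fun q ↦ ((trivializationAt E (TangentSpace I : M → Type _)
        (f p)) ⟨f q, s q⟩).2) p :=
  mdifferentiableAt_totalSpace _ _

theorem eventually_mem_baseSet (hf : MDiffAt f p) {x : M}
    (hx : f p ∈ (trivializationAt E (TangentSpace I : M → Type _) x).baseSet) :
    ∀ᶠ q in 𝓝 p, f q ∈ (trivializationAt E (TangentSpace I : M → Type _) x).baseSet :=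
  hf.continuousAt.preimage_mem_nhds ((Trivialization.open_baseSet _).mem_nhds hx)

theorem trivialization_snd_add {x y : M}
    (hy : y ∈ (trivializationAt E (TangentSpace I : M → Type _) x).baseSet)
    (v w : TangentSpace I y) :
    (trivializationAt E (TangentSpace I : M → Type _) x ⟨y, v + w⟩).2
      = (trivializationAt E (TangentSpace I : M → Type _) x ⟨y, v⟩).2
        + (trivializationAt E (TangentSpace I : M → Type _) x ⟨y, w⟩).2 :=
  ((trivializationAt E (TangentSpace I : M → Type _) x).linear ℝ hy).map_add v w

theorem trivialization_snd_smul {x y : M}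
    (hy : y ∈ (trivializationAt E (TangentSpace I : M → Type _) x).baseSet)
    (c : ℝ) (v : TangentSpace I y) :
    (trivializationAt E (TangentSpace I : M → Type _) x ⟨y, c • v⟩).2
      = c • (trivializationAt E (TangentSpace I : M → Type _) x ⟨y, v⟩).2 :=
  ((trivializationAt E (TangentSpace I : M → Type _) x).linear ℝ hy).map_smul c v

theorem trivialization_symm_add {x y : M}
    (hy : y ∈ (trivializationAt E (TangentSpace I : M → Type _) x).baseSet) (v w : E) :
    (trivializationAt E (TangentSpace I : M → Type _) x).symm y (v + w)
      = (trivializationAt E (TangentSpace I : M → Type _) x).symm y v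
        + (trivializationAt E (TangentSpace I : M → Type _) x).symm y w := by
  simp only [← Trivialization.symmL_apply (R := ℝ) _ hy, map_add]

theorem trivialization_symm_smul {x y : M}
    (hy : y ∈ (trivializationAt E (TangentSpace I : M → Type _) x).baseSet) (c : ℝ) (v : E) :
    (trivializationAt E (TangentSpace I : M → Type _) x).symm y (c • v)
      = c • (trivializationAt E (TangentSpace I : M → Type _) x).symm y v := by
  simp only [← Trivialization.symmL_apply (R := ℝ) _ hy, map_smul]

theorem eventually_mem_baseSet_self (x : M) :
    ∀ᶠ y in 𝓝 x, y ∈ (trivializationAt E (TangentSpace I : M → Type _) x).baseSet :=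
  (trivializationAt E (TangentSpace I : M → Type _) x).open_baseSet.mem_nhds
    (FiberBundle.mem_baseSet_trivializationAt' x)

theorem leviCivita_extend_add {x : M} (v w u : TangentSpace I x) :
    leviCivita I (FiberBundle.extend E (v + w)) x u
      = leviCivita I (FiberBundle.extend E v) x u + leviCivita I (FiberBundle.extend E w) x u := by
  have hv := mdifferentiableAt_extend v
  have hw := mdifferentiableAt_extend w
  rw [← leviCivita_add hv hw]
  refine leviCivita_congr (mdifferentiableAt_extend _) (mdifferentiableAt_add_section hv hw) ?_ u
  filter_upwards [eventually_mem_baseSet_self (I := I) x] with y hy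
  simp only [FiberBundle.extend, Pi.add_apply,
    trivialization_snd_add (FiberBundle.mem_baseSet_trivializationAt' x),
    trivialization_symm_add hy]

theorem leviCivita_extend_smul {x : M} (c : ℝ) (v u : TangentSpace I x) :
    leviCivita I (FiberBundle.extend E (c • v)) x u
      = c • leviCivita I (FiberBundle.extend E v) x u := by
  have hv := mdifferentiableAt_extend v
  have hc : MDiffAt (fun _ : M ↦ c) x := mdifferentiableAt_const
  have h := leviCivita_smul hc hv u
  rw [mvfderiv_const, _root_.zero_apply, zero_smul, add_zero] at h
  rw [← h]
  refine leviCivita_congr (mdifferentiableAt_extend _) (hc.smul_section hv) ?_ u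
  filter_upwards [eventually_mem_baseSet_self (I := I) x] with y hy
  simp only [FiberBundle.extend, Pi.smul_apply',
    trivialization_snd_smul (FiberBundle.mem_baseSet_trivializationAt' x),
    trivialization_symm_smul hy]

theorem MDiffAlongAt.mdifferentiableAt (hs : MDiffAlongAt I I' f s p) : MDiffAt f p :=
  (mdiffAlongAt_iff.1 hs).1

theorem MDiffAlongAt.add (hs : MDiffAlongAt I I' f s p) (hs' : MDiffAlongAt I I' f s' p) :
    MDiffAlongAt I I' f (fun q ↦ s q + s' q) p := by
  have hf := hs.mdifferentiableAt
  rw [mdiffAlongAt_iff] at hs hs' ⊢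
  refine ⟨hf, (hs.2.add hs'.2).congr_of_eventuallyEq ?_⟩
  filter_upwards [eventually_mem_baseSet hf (FiberBundle.mem_baseSet_trivializationAt' (f p))]
    with q hq using trivialization_snd_add hq _ _

theorem MDiffAlongAt.smul (hφ : MDiffAt φ p) (hs : MDiffAlongAt I I' f s p) :
    MDiffAlongAt I I' f (fun q ↦ φ q • s q) p := by
  have hf := hs.mdifferentiableAt
  rw [mdiffAlongAt_iff] at hs ⊢
  refine ⟨hf, (hφ.smul hs.2).congr_of_eventuallyEq ?_⟩
  filter_upwards [eventually_mem_baseSet hf (FiberBundle.mem_baseSet_trivializationAt' (f p))]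
    with q hq using trivialization_snd_smul hq _ _

theorem mdiffAlongAt_comp (hf : MDiffAt f p) {Y : Π x : M, TangentSpace I x}
    (hY : MDiffAt (T% Y) (f p)) : MDiffAlongAt I I' f (fun q ↦ Y (f q)) p :=
  MDifferentiableAt.comp p hY hf

theorem covAlong_congr (h : ∀ᶠ q in 𝓝 p, s q = s' q) :
    covAlong I I' f s p u = covAlong I I' f s' p u := by
  have h1 : (fun q ↦ (trivializationAt E (TangentSpace I : M → Type _) (f p) ⟨f q, s q⟩).2)
      =ᶠ[𝓝 p] fun q ↦ (trivializationAt E (TangentSpace I : M → Type _) (f p) ⟨f q, s' q⟩).2 :=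
    h.mono fun q hq ↦ by simp only [hq]
  rw [covAlong, covAlong, mvfderiv_congr h1, h.self_of_nhds]

theorem covAlong_add (hs : MDiffAlongAt I I' f s p) (hs' : MDiffAlongAt I I' f s' p) :
    covAlong I I' f (fun q ↦ s q + s' q) p u
      = covAlong I I' f s p u + covAlong I I' f s' p u := by
  have hf := hs.mdifferentiableAt
  have h1 : (fun q ↦ (trivializationAt E (TangentSpace I : M → Type _) (f p)
        ⟨f q, s q + s' q⟩).2)
      =ᶠ[𝓝 p] fun q ↦ (trivializationAt E (TangentSpace I : M → Type _) (f p) ⟨f q, s q⟩).2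
        + (trivializationAt E (TangentSpace I : M → Type _) (f p) ⟨f q, s' q⟩).2 := by
    filter_upwards [eventually_mem_baseSet hf (FiberBundle.mem_baseSet_trivializationAt' (f p))]
      with q hq using trivialization_snd_add hq _ _
  rw [mdiffAlongAt_iff] at hs hs'
  rw [covAlong, covAlong, covAlong, mvfderiv_congr h1, mvfderiv_fun_add hs.2 hs'.2,
    leviCivita_extend_add, _root_.add_apply,
    trivialization_symm_add (FiberBundle.mem_baseSet_trivializationAt' _)]
  abel

theorem covAlong_smul (hφ : MDiffAt φ p) (hs : MDiffAlongAt I I' f s p) :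
    covAlong I I' f (fun q ↦ φ q • s q) p u
      = φ p • covAlong I I' f s p u + mvfderiv I' φ p u • s p := by
  have hf := hs.mdifferentiableAt
  have hp := FiberBundle.mem_baseSet_trivializationAt' (F := E)
    (E := (TangentSpace I : M → Type _)) (f p)
  have h1 : (fun q ↦ (trivializationAt E (TangentSpace I : M → Type _) (f p)
        ⟨f q, φ q • s q⟩).2)
      =ᶠ[𝓝 p] fun q ↦ φ q •
        (trivializationAt E (TangentSpace I : M → Type _) (f p) ⟨f q, s q⟩).2 := by
    filter_upwards [eventually_mem_baseSet hf hp]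
      with q hq using trivialization_snd_smul hq _ _
  rw [mdiffAlongAt_iff] at hs
  rw [covAlong, covAlong, mvfderiv_congr h1, mvfderiv_fun_smul hφ hs.2, leviCivita_extend_smul,
    _root_.add_apply, trivialization_symm_add hp, _root_.smul_apply, trivialization_symm_smul hp,
    ContinuousLinearMap.smulRight_apply, trivialization_symm_smul hp,
    Trivialization.symm_apply_apply_mk _ hp]
  simp only [smul_add]
  abel

theorem MDiffAlongAt.sum {ι : Type*} (t : Finset ι) {S : ι → Π q : B, TangentSpace I (f q)}
    (hf : MDiffAt f p) (hS : ∀ i ∈ t, MDiffAlongAt I I' f (S i) p) :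
    MDiffAlongAt I I' f (fun q ↦ ∑ i ∈ t, S i q) p := by
  classical
  induction t using Finset.induction_on with
  | empty =>
    simpa using mdiffAlongAt_comp hf (Y := (0 : Π x : M, TangentSpace I x))
      (mdifferentiableAt_zeroSection ..)
  | insert i t hi ih =>
    simp only [Finset.sum_insert hi]
    exact (hS i (Finset.mem_insert_self i t)).add
      (ih fun j hj ↦ hS j (Finset.mem_insert_of_mem hj))

/-- An operation on vector fields along `f` that is additive and homogeneous over functions
only depends on the value of the vector field at the point. -/
theorem tensorialAlong_pointwise {A : Type*} [AddCommGroup A] [Module ℝ A]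
    {Φ : (Π q : B, TangentSpace I (f q)) → A}
    (hsmul : ∀ {φ : B → ℝ} {s : Π q : B, TangentSpace I (f q)}, MDiffAt φ p →
      MDiffAlongAt I I' f s p → Φ (fun q ↦ φ q • s q) = φ p • Φ s)
    (hadd : ∀ {s s' : Π q : B, TangentSpace I (f q)}, MDiffAlongAt I I' f s p →
      MDiffAlongAt I I' f s' p → Φ (fun q ↦ s q + s' q) = Φ s + Φ s')
    (hs : MDiffAlongAt I I' f s p) (hs' : MDiffAlongAt I I' f s' p) (h : s p = s' p) :
    Φ s = Φ s' := by
  classical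
  have hf := hs.mdifferentiableAt
  have hlocal : ∀ {s s' : Π q : B, TangentSpace I (f q)}, MDiffAlongAt I I' f s p →
      MDiffAlongAt I I' f s' p → (∀ᶠ q in 𝓝 p, s q = s' q) → Φ s = Φ s' := by
    intro s s' hs hs' h
    let ψ : B → ℝ := fun q ↦ if s q = s' q then 1 else 0
    have hev : ψ =ᶠ[𝓝 p] fun _ ↦ 1 := h.mono fun y hy ↦ by simp [ψ, hy]
    have hψ : MDiffAt ψ p := (mdifferentiableAt_const (c := (1 : ℝ))).congr_of_eventuallyEq hev
    have hψx : ψ p = 1 := hev.self_of_nhds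
    have e : (fun q ↦ ψ q • s q) = fun q ↦ ψ q • s' q := by
      funext q
      by_cases hq : s q = s' q <;> simp [ψ, hq]
    have h1 := hsmul hψ hs
    rw [e, hsmul hψ hs', hψx, one_smul, one_smul] at h1
    exact h1.symm
  let b := Module.finBasis ℝ E
  let e := trivializationAt E (TangentSpace I : M → Type _) (f p)
  have hp : f p ∈ e.baseSet := FiberBundle.mem_baseSet_trivializationAt' (f p)
  have hframe : ∀ i, MDiffAt (T% (e.localFrame b i)) (f p) := fun i ↦
    (contMDiffAt_localFrame_of_mem (I := I) 1 e b i hp).mdifferentiableAt one_ne_zero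
  let c : (Π q : B, TangentSpace I (f q)) → _ → B → ℝ := fun s i q ↦ b.repr (e ⟨f q, s q⟩).2 i
  have hc : ∀ {s : Π q : B, TangentSpace I (f q)}, MDiffAlongAt I I' f s p →
      ∀ i, MDiffAt (c s i) p := by
    intro s hs i
    have h2 := (mdiffAlongAt_iff.1 hs).2
    exact (LinearMap.toContinuousLinearMap (b.coord i)).contMDiff.contMDiffAt.mdifferentiableAt
      one_ne_zero |>.comp p h2
  have hterm : ∀ {s : Π q : B, TangentSpace I (f q)}, MDiffAlongAt I I' f s p → ∀ i,
      MDiffAlongAt I I' f (fun q ↦ c s i q • e.localFrame b i (f q)) p := fun hs i ↦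
    (mdiffAlongAt_comp hf (hframe i)).smul (hc hs i)
  have hzero : Φ (fun q ↦ 0) = 0 := by
    have h0 : MDiffAlongAt I I' f (fun q ↦ 0) p :=
      mdiffAlongAt_comp hf (Y := (0 : Π x : M, TangentSpace I x)) (mdifferentiableAt_zeroSection ..)
    simpa using hadd h0 h0
  have hsum : ∀ {s : Π q : B, TangentSpace I (f q)} (_ : MDiffAlongAt I I' f s p)
      (t : Finset (Fin (Module.finrank ℝ E))),
      Φ (fun q ↦ ∑ i ∈ t, c s i q • e.localFrame b i (f q))
        = ∑ i ∈ t, Φ (fun q ↦ c s i q • e.localFrame b i (f q)) := by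
    intro s hs t
    induction t using Finset.induction_on with
    | empty => simpa using hzero
    | insert i t hi ih =>
      simp only [Finset.sum_insert hi]
      rw [hadd (hterm hs i) (MDiffAlongAt.sum t hf fun i _ ↦ hterm hs i), ih]
  have hexp : ∀ {s : Π q : B, TangentSpace I (f q)} (_ : MDiffAlongAt I I' f s p),
      Φ s = ∑ i, c s i p • Φ (fun q ↦ e.localFrame b i (f q)) := by
    intro s hs
    rw [hlocal hs (MDiffAlongAt.sum Finset.univ hf fun i _ ↦ hterm hs i), hsum hs]
    · exact Finset.sum_congr rfl fun i _ ↦ hsmul (hc hs i) (mdiffAlongAt_comp hf (hframe i))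
    · filter_upwards [eventually_mem_baseSet hf hp] with q hq
      have h1 : ∀ i, e.localFrame b i (f q) = e.symmL ℝ (f q) (b i) := by
        intro i
        rw [e.localFrame_apply_of_mem_baseSet b hq, Trivialization.basisAt, Module.Basis.map_apply,
          Trivialization.symmL_apply _ hq]
        rfl
      simp only [c, h1, ← map_smul, ← map_sum, b.sum_repr]
      rw [Trivialization.symmL_apply _ hq, Trivialization.symm_apply_apply_mk _ hq]
  rw [hexp hs, hexp hs']
  simp only [c, h]

theorem leviCivita_eq_symm_add {Y : Π x : M, TangentSpace I x} {x : M} (hY : MDiffAt (T% Y) x)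
    (v : TangentSpace I x) :
    leviCivita I Y x v = (trivializationAt E (TangentSpace I : M → Type _) x).symm x
        (mvfderiv I (fun y ↦ (trivializationAt E (TangentSpace I : M → Type _) x ⟨y, Y y⟩).2) x v)
      + leviCivita I (FiberBundle.extend E (Y x)) x v := by
  let e := trivializationAt E (TangentSpace I : M → Type _) x
  have hx : x ∈ e.baseSet := FiberBundle.mem_baseSet_trivializationAt' x
  have hb : ∀ᶠ y in 𝓝 x, y ∈ e.baseSet := e.open_baseSet.mem_nhds hx
  have hT : TensorialAt I E (fun Y ↦ leviCivita I Y x v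
      - e.symm x (mvfderiv I (fun y ↦ (e ⟨y, Y y⟩).2) x v)) x := by
    constructor
    · intro φ s hφ hs
      have h1 : (fun y ↦ (e ⟨y, (φ • s) y⟩).2) =ᶠ[𝓝 x] fun y ↦ φ y • (e ⟨y, s y⟩).2 :=
        hb.mono fun y hy ↦ trivialization_snd_smul hy _ _
      have hs2 := (mdifferentiableAt_section I s).1 hs
      rw [leviCivita_smul hφ hs, mvfderiv_congr h1, mvfderiv_fun_smul hφ hs2, _root_.add_apply,
        trivialization_symm_add hx, _root_.smul_apply, trivialization_symm_smul hx,
        ContinuousLinearMap.smulRight_apply, trivialization_symm_smul hx,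
        Trivialization.symm_apply_apply_mk _ hx, smul_sub]
      abel
    · intro s s' hs hs'
      have h1 : (fun y ↦ (e ⟨y, (s + s') y⟩).2)
          =ᶠ[𝓝 x] fun y ↦ (e ⟨y, s y⟩).2 + (e ⟨y, s' y⟩).2 :=
        hb.mono fun y hy ↦ trivialization_snd_add hy _ _
      have hs2 := (mdifferentiableAt_section I s).1 hs
      have hs2' := (mdifferentiableAt_section I s').1 hs'
      rw [leviCivita_add hs hs', mvfderiv_congr h1, mvfderiv_fun_add hs2 hs2', _root_.add_apply,
        trivialization_symm_add hx]
      abel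
  have h := hT.pointwise hY (mdifferentiableAt_extend (Y x)) (by simp)
  have h2 : (fun y ↦ (e ⟨y, FiberBundle.extend E (Y x) y⟩).2) =ᶠ[𝓝 x]
      fun _ ↦ (e ⟨x, Y x⟩).2 :=
    hb.mono fun y hy ↦ by
      change (e ⟨y, e.symm y (e ⟨x, Y x⟩).2⟩).2 = _
      rw [e.apply_mk_symm hy]
  simp only [mvfderiv_congr h2, mvfderiv_const, _root_.zero_apply] at h
  have h0 : e.symm x (0 : E) = 0 := by
    rw [← Trivialization.symmL_apply (R := ℝ) _ hx, map_zero]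
  rw [h0, sub_zero] at h
  rw [← h]
  simp [e]

/-- The covariant derivative along `f` of the restriction of a vector field to `f`. -/
theorem covAlong_comp (hf : MDiffAt f p) {Y : Π x : M, TangentSpace I x}
    (hY : MDiffAt (T% Y) (f p)) :
    covAlong I I' f (fun q ↦ Y (f q)) p u = leviCivita I Y (f p) (mfderiv I' I f p u) := by
  rw [leviCivita_eq_symm_add hY, covAlong]
  congr 2
  exact mvfderiv_comp_apply' (g := fun y ↦ (trivializationAt E (TangentSpace I : M → Type _) (f p)
    ⟨y, Y y⟩).2) ((mdifferentiableAt_section I Y).1 hY) hf u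

theorem mdifferentiableAt_inner_along (hs : MDiffAlongAt I I' f s p)
    (hs' : MDiffAlongAt I I' f s' p) : MDiffAt (fun q ↦ inner ℝ (s q) (s' q)) p :=
  MDifferentiableAt.inner_bundle (b := f) hs hs'

/-- The covariant derivative along a map is compatible with the metric. -/
theorem mvfderiv_inner_along (hs : MDiffAlongAt I I' f s p) (hs' : MDiffAlongAt I I' f s' p) :
    mvfderiv I' (fun q ↦ inner ℝ (s q) (s' q)) p u
      = inner ℝ (covAlong I I' f s p u) (s' p) + inner ℝ (s p) (covAlong I I' f s' p u) := by
  have hf := hs.mdifferentiableAt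
  let Φ : (Π q : B, TangentSpace I (f q)) → (Π q : B, TangentSpace I (f q)) → ℝ := fun s s' ↦
    mvfderiv I' (fun q ↦ inner ℝ (s q) (s' q)) p u
      - inner ℝ (covAlong I I' f s p u) (s' p) - inner ℝ (s p) (covAlong I I' f s' p u)
  have hsymm : ∀ s s', Φ s s' = Φ s' s := by
    intro s s'
    simp only [Φ, real_inner_comm (s p), real_inner_comm (s' p)]
    rw [show (fun q ↦ inner ℝ (s q) (s' q)) = fun q ↦ inner ℝ (s' q) (s q) from
      funext fun q ↦ real_inner_comm _ _]
    ring
  have key : ∀ {s s' t : Π q : B, TangentSpace I (f q)}, MDiffAlongAt I I' f s p →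
      MDiffAlongAt I I' f s' p → MDiffAlongAt I I' f t p → s p = s' p → Φ s t = Φ s' t := by
    intro s s' t hs hs' ht h
    refine tensorialAlong_pointwise (Φ := fun s ↦ Φ s t) ?_ ?_ hs hs' h
    · intro φ s hφ hs
      simp only [Φ, inner_smul_left, RCLike.conj_to_real]
      rw [mvfderiv_fun_mul hφ (mdifferentiableAt_inner_along hs ht), covAlong_smul hφ hs,
        inner_add_left, inner_smul_left, inner_smul_left, _root_.add_apply, _root_.smul_apply,
        _root_.smul_apply]
      simp only [RCLike.conj_to_real, smul_eq_mul]
      ring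
    · intro s s' hs hs'
      simp only [Φ, inner_add_left]
      rw [mvfderiv_fun_add (mdifferentiableAt_inner_along hs ht)
        (mdifferentiableAt_inner_along hs' ht), covAlong_add hs hs', inner_add_left,
        _root_.add_apply]
      ring
  have he := mdifferentiableAt_extend (s p)
  have he' := mdifferentiableAt_extend (s' p)
  have hc := mdiffAlongAt_comp (I' := I') hf he
  have hc' := mdiffAlongAt_comp (I' := I') hf he'
  have h : Φ s s' = 0 := by
    rw [key hs hc hs' (by simp), hsymm, key hs' hc' hc (by simp), hsymm]
    simp only [Φ]
    rw [covAlong_comp hf he, covAlong_comp hf he',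
      mvfderiv_comp_apply' (g := fun y ↦ inner ℝ (FiberBundle.extend E (s p) y)
        (FiberBundle.extend E (s' p) y)) (mdifferentiableAt_inner he he') hf,
      mvfderiv_inner he he']
    ring
  simp only [Φ] at h
  linarith

end Along

theorem one_add_one_le_infty : (1 + 1 : WithTop ℕ∞) ≤ ∞ := by
  rw [one_add_one_eq_two]
  exact ENat.LEInfty.out

theorem mvfderiv_eq_fderiv {E G : Type*} [NormedAddCommGroup E] [NormedSpace ℝ E]
    [NormedAddCommGroup G] [NormedSpace ℝ G] (f : E → G) (x w : E) :
    mvfderiv 𝓘(ℝ, E) f x w = fderiv ℝ f x w := by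
  rw [mvfderiv, mfderiv_eq_fderiv]
  rfl

section Endomorphisms

variable {E : Type*} [NormedAddCommGroup E] [NormedSpace ℝ E] [FiniteDimensional ℝ E]
  {H : Type*} [TopologicalSpace H] {I : ModelWithCorners ℝ E H}
  {M : Type*} [TopologicalSpace M] [ChartedSpace H M] [IsManifold I ∞ M]
  [RiemannianBundle (fun x : M ↦ TangentSpace I x)]
  [IsContMDiffRiemannianBundle I ∞ E (fun x : M ↦ TangentSpace I x)]
  {A : Π y : M, TangentSpace I y →L[ℝ] TangentSpace I y} {x : M} {W : Set M}
  {Y : Π y : M, TangentSpace I y}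

variable (I) in
/-- The family `A` of endomorphisms of the tangent spaces is differentiable at `x`. -/
def MDiffEndAt (A : Π y : M, TangentSpace I y →L[ℝ] TangentSpace I y) (x : M) : Prop :=
  MDifferentiableAt I (I.prod 𝓘(ℝ, E →L[ℝ] E))
    (fun y ↦ Bundle.TotalSpace.mk' (E →L[ℝ] E)
      (E := fun y : M ↦ TangentSpace I y →L[ℝ] TangentSpace I y) y (A y)) x

theorem SmoothEndOn.mdiffEndAt (hA : SmoothEndOn I A W) (hW : IsOpen W) (hx : x ∈ W) :
    MDiffEndAt I A x :=
  (ContMDiffOn.contMDiffAt hA (hW.mem_nhds hx)).mdifferentiableAt (by simp)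

theorem MDiffEndAt.apply (hA : MDiffEndAt I A x) (hY : MDiffAt (T% Y) x) :
    MDiffAt (T% (fun y ↦ A y (Y y))) x :=
  MDifferentiableAt.clm_bundle_apply (F₁ := E) (F₂ := E) (b := fun y : M ↦ y) hA hY

variable (I) in
/-- The covariant derivative of a family of endomorphisms, `(∇_v A) w`. -/
noncomputable def covEnd (A : Π y : M, TangentSpace I y →L[ℝ] TangentSpace I y) (x : M)
    (v w : TangentSpace I x) : TangentSpace I x :=
  leviCivita I (fun y ↦ A y (FiberBundle.extend E w y)) x v
    - A x (leviCivita I (FiberBundle.extend E w) x v)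

theorem leviCivita_apply (hA : MDiffEndAt I A x) (hY : MDiffAt (T% Y) x) (v : TangentSpace I x) :
    leviCivita I (fun y ↦ A y (Y y)) x v = covEnd I A x v (Y x) + A x (leviCivita I Y x v) := by
  have hT : TensorialAt I E (fun Y ↦ leviCivita I (fun y ↦ A y (Y y)) x v
      - A x (leviCivita I Y x v)) x := by
    constructor
    · intro φ s hφ hs
      have e : (fun y ↦ A y ((φ • s) y)) = φ • fun y ↦ A y (s y) := by
        funext y
        simp
      rw [e, leviCivita_smul hφ hs, leviCivita_smul hφ (hA.apply hs), map_add, map_smul, map_smul,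
        smul_sub]
      abel
    · intro s s' hs hs'
      have e : (fun y ↦ A y ((s + s') y)) = (fun y ↦ A y (s y)) + fun y ↦ A y (s' y) := by
        funext y
        simp
      rw [e, leviCivita_add hs hs', leviCivita_add (hA.apply hs) (hA.apply hs'), map_add]
      abel
  rw [← sub_eq_iff_eq_add, hT.pointwise hY (mdifferentiableAt_extend (Y x)) (by simp), covEnd]

theorem covEnd_add_left (hA : MDiffEndAt I A x) (v v' w : TangentSpace I x) :
    covEnd I A x (v + v') w = covEnd I A x v w + covEnd I A x v' w := by
  have h := mdifferentiableAt_extend w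
  rw [covEnd, covEnd, covEnd, leviCivita_add_right h, leviCivita_add_right (hA.apply h), map_add]
  abel

theorem covEnd_smul_left (hA : MDiffEndAt I A x) (c : ℝ) (v w : TangentSpace I x) :
    covEnd I A x (c • v) w = c • covEnd I A x v w := by
  have h := mdifferentiableAt_extend w
  rw [covEnd, covEnd, leviCivita_smul_right h, leviCivita_smul_right (hA.apply h), map_smul,
    smul_sub]

theorem covEnd_add_right (hA : MDiffEndAt I A x) (v w w' : TangentSpace I x) :
    covEnd I A x v (w + w') = covEnd I A x v w + covEnd I A x v w' := by
  have h := mdifferentiableAt_extend w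
  have h' := mdifferentiableAt_extend w'
  have e := leviCivita_apply hA (mdifferentiableAt_add_section h h') v
  have e1 := leviCivita_apply hA h v
  have e2 := leviCivita_apply hA h' v
  have e3 : (fun y ↦ A y ((FiberBundle.extend E w + FiberBundle.extend E w' :
      Π y : M, TangentSpace I y) y)) = (fun y ↦ A y (FiberBundle.extend E w y))
        + fun y ↦ A y (FiberBundle.extend E w' y) := by
    funext y
    simp
  rw [e3, leviCivita_add (hA.apply h) (hA.apply h'), leviCivita_add h h', map_add, e1, e2] at e
  simp only [Pi.add_apply, FiberBundle.extend_apply_self] at e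
  have h0 : ∀ a b c d f : TangentSpace I x, a + b + (c + d) = f + (b + d) → f = a + c := by
    intro a b c d f hh
    have : a + c + (b + d) = f + (b + d) := by rw [← hh]; abel
    exact (add_right_cancel this).symm
  exact h0 _ _ _ _ _ e

section AlongMaps

variable {E' : Type*} [NormedAddCommGroup E'] [NormedSpace ℝ E']
  {H' : Type*} [TopologicalSpace H'] {I' : ModelWithCorners ℝ E' H'}
  {B : Type*} [TopologicalSpace B] [ChartedSpace H' B]
  {f : B → M} {s : Π q : B, TangentSpace I (f q)} {p : B} {u : TangentSpace I' p}

theorem MDiffEndAt.apply_along (hA : MDiffEndAt I A (f p)) (hs : MDiffAlongAt I I' f s p) :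
    MDiffAlongAt I I' f (fun q ↦ A (f q) (s q)) p := by
  have h : MDifferentiableAt I' (I.prod 𝓘(ℝ, E →L[ℝ] E))
    (fun q ↦ Bundle.TotalSpace.mk' (E →L[ℝ] E)
      (E := fun y : M ↦ TangentSpace I y →L[ℝ] TangentSpace I y) (f q) (A (f q))) p :=
    MDifferentiableAt.comp p hA hs.mdifferentiableAt
  exact MDifferentiableAt.clm_bundle_apply (F₁ := E) (F₂ := E) (b := f) h hs

theorem covAlong_apply (hA : MDiffEndAt I A (f p)) (hs : MDiffAlongAt I I' f s p) :
    covAlong I I' f (fun q ↦ A (f q) (s q)) p u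
      = covEnd I A (f p) (mfderiv I' I f p u) (s p) + A (f p) (covAlong I I' f s p u) := by
  have hf := hs.mdifferentiableAt
  have he := mdifferentiableAt_extend (s p)
  have h := tensorialAlong_pointwise
    (Φ := fun s : Π q : B, TangentSpace I (f q) ↦ covAlong I I' f (fun q ↦ A (f q) (s q)) p u
      - A (f p) (covAlong I I' f s p u)) ?_ ?_ hs (mdiffAlongAt_comp hf he) (by simp)
  · rw [covAlong_comp hf he, covAlong_comp hf (Y := fun y ↦ A y (FiberBundle.extend E (s p) y))
      (hA.apply he), leviCivita_apply hA he, FiberBundle.extend_apply_self, add_sub_cancel_right]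
      at h
    rw [← h, sub_add_cancel]
  · intro φ s hφ hs
    simp only [map_smul]
    rw [covAlong_smul hφ hs, covAlong_smul hφ (hA.apply_along hs), map_add, map_smul, map_smul,
      smul_sub]
    abel
  · intro s s' hs hs'
    simp only [map_add]
    rw [covAlong_add hs hs', covAlong_add (hA.apply_along hs) (hA.apply_along hs'), map_add]
    abel

end AlongMaps

end Endomorphisms

section SecondFundamentalForm

variable {E : Type*} [NormedAddCommGroup E] [NormedSpace ℝ E] [FiniteDimensional ℝ E]
  {H : Type*} [TopologicalSpace H] {I : ModelWithCorners ℝ E H}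
  {M : Type*} [TopologicalSpace M] [ChartedSpace H M] [IsManifold I ∞ M]
  [RiemannianBundle (fun x : M ↦ TangentSpace I x)]
  [IsContMDiffRiemannianBundle I ∞ E (fun x : M ↦ TangentSpace I x)]
  {E' : Type*} [NormedAddCommGroup E'] [NormedSpace ℝ E'] [FiniteDimensional ℝ E']
  {H' : Type*} [TopologicalSpace H'] {I' : ModelWithCorners ℝ E' H'}
  {N : Type*} [TopologicalSpace N] [ChartedSpace H' N] [IsManifold I' ∞ N]
  [RiemannianBundle (fun x : N ↦ TangentSpace I' x)]
  [IsContMDiffRiemannianBundle I' ∞ E' (fun x : N ↦ TangentSpace I' x)]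
  {F : M → N} {p : M} {V : Π q : M, TangentSpace I q}

theorem contMDiffAt_mfderiv_apply (hF : ContMDiff I I' ∞ F) (hV : CMDiffAt ∞ (T% V) p) :
    ContMDiffAt I I'.tangent ∞
      (fun q ↦ (⟨F q, mfderiv I I' F q (V q)⟩ : TangentBundle I' N)) p :=
  ContMDiffAt.comp p ((hF.contMDiff_tangentMap (m := ∞) le_rfl).contMDiffAt) hV

theorem mdiffAlongAt_mfderiv_apply (hF : ContMDiff I I' ∞ F) (hV : MDiffAt (T% V) p) :
    MDiffAlongAt I' I F (fun q ↦ mfderiv I I' F q (V q)) p :=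
  MDifferentiableAt.comp p
    ((hF.contMDiff_tangentMap (m := 1) one_add_one_le_infty).mdifferentiable one_ne_zero _) hV

theorem secondFundamentalForm_eq (hF : ContMDiff I I' ∞ F) (hV : MDiffAt (T% V) p)
    (u : TangentSpace I p) :
    secondFundamentalForm I I' F p u (V p)
      = covAlong I' I F (fun q ↦ mfderiv I I' F q (V q)) p u
        - mfderiv I I' F p (leviCivita I V p u) := by
  have hT : TensorialAt I E (fun V ↦ covAlong I' I F (fun q ↦ mfderiv I I' F q (V q)) p u
        - mfderiv I I' F p (leviCivita I V p u)) p := by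
    constructor
    · intro φ s hφ hs
      simp only [Pi.smul_apply', map_smul]
      rw [leviCivita_smul hφ hs, covAlong_smul hφ (mdiffAlongAt_mfderiv_apply hF hs), map_add,
        map_smul, map_smul, smul_sub]
      abel
    · intro s s' hs hs'
      simp only [Pi.add_apply, map_add]
      rw [leviCivita_add hs hs', covAlong_add (mdiffAlongAt_mfderiv_apply hF hs)
        (mdiffAlongAt_mfderiv_apply hF hs'), map_add]
      abel
  rw [secondFundamentalForm]
  exact hT.pointwise (mdifferentiableAt_extend (V p)) hV (by simp)

theorem secondFundamentalForm_add_right (hF : ContMDiff I I' ∞ F) (u v w : TangentSpace I p) :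
    secondFundamentalForm I I' F p u (v + w)
      = secondFundamentalForm I I' F p u v + secondFundamentalForm I I' F p u w := by
  have hv := mdifferentiableAt_extend v
  have hw := mdifferentiableAt_extend w
  have h := secondFundamentalForm_eq hF (mdifferentiableAt_add_section hv hw) u
  simp only [Pi.add_apply, FiberBundle.extend_apply_self, map_add] at h
  rw [h, leviCivita_add hv hw, covAlong_add (mdiffAlongAt_mfderiv_apply hF hv)
    (mdiffAlongAt_mfderiv_apply hF hw), map_add, secondFundamentalForm, secondFundamentalForm]
  abel

theorem secondFundamentalForm_smul_right (hF : ContMDiff I I' ∞ F) (c : ℝ)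
    (u v : TangentSpace I p) :
    secondFundamentalForm I I' F p u (c • v) = c • secondFundamentalForm I I' F p u v := by
  have hv := mdifferentiableAt_extend v
  have hc : MDiffAt (fun _ : M ↦ c) p := mdifferentiableAt_const
  have h := secondFundamentalForm_eq hF (hc.smul_section hv) u
  simp only [Pi.smul_apply', FiberBundle.extend_apply_self, map_smul] at h
  rw [h, leviCivita_smul hc hv, covAlong_smul hc (mdiffAlongAt_mfderiv_apply hF hv),
    mvfderiv_const, secondFundamentalForm]
  simp only [_root_.zero_apply, zero_smul, add_zero, map_smul, smul_sub]

section Symmetry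

variable [I.Boundaryless] [I'.Boundaryless]

theorem mlieBracket_extend (u v : TangentSpace I p) :
    mlieBracket I (FiberBundle.extend E u) (FiberBundle.extend E v) p = 0 := by
  have : CompleteSpace E := FiniteDimensional.complete ℝ E
  have h3 : (3 : WithTop ℕ∞) ≤ ∞ := ENat.LEInfty.out
  have : IsManifold I (minSmoothness ℝ 3) M := IsManifold.of_le (n := ∞) (by simpa using h3)
  let e := trivializationAt E (TangentSpace I : M → Type _) p
  let C : TangentSpace I p → Π z : E, TangentSpace 𝓘(ℝ, E) z := fun v _ ↦ (e ⟨p, v⟩).2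
  have hC : ∀ v z, MDiffAt (T% (C v)) z := fun v z ↦
    ((contMDiffAt_vectorSpace_iff_contDiffAt (n := 1)).2
      (contDiffAt_const (c := (e ⟨p, v⟩).2))).mdifferentiableAt one_ne_zero
  have key : ∀ v : TangentSpace I p, (FiberBundle.extend E v : Π q : M, TangentSpace I q) =ᶠ[𝓝 p]
      mpullback I 𝓘(ℝ, E) (extChartAt I p) (C v) := by
    intro v
    filter_upwards [eventually_mem_baseSet_self (I := I) p] with q hq
    have hq' : q ∈ (chartAt H p).source := hq
    have hq'' : q ∈ (extChartAt I p).source := by rwa [extChartAt_source]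
    have h1 := mfderiv_extChartAt_comp_mfderivWithin_extChartAt_symm' hq''
    have h2 := mfderivWithin_extChartAt_symm_comp_mfderiv_extChartAt' hq''
    rw [mpullback_apply, ContinuousLinearMap.inverse_eq h1 h2,
      ← TangentBundle.symmL_trivializationAt hq']
    exact (Trivialization.symmL_apply _ hq _).symm
  rw [(key u).mlieBracket_vectorField_eq (key v)]
  have h := mpullback_mlieBracket (I := I) (I' := 𝓘(ℝ, E)) (f := extChartAt I p) (x₀ := p)
    (V := C u) (W := C v) (n := 2) (hC u _) (hC v _) contMDiffAt_extChartAt (by simp)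
  have hb : mlieBracket 𝓘(ℝ, E) (C u) (C v) (extChartAt I p p) = 0 := by
    rw [← mlieBracketWithin_univ, mlieBracketWithin_eq_lieBracketWithin]
    simp only [lieBracketWithin, C, fderivWithin_fun_const]
    exact sub_self _
  rw [← h, mpullback_apply, hb]
  exact map_zero (mfderiv I 𝓘(ℝ, E) (extChartAt I p) p).inverse

theorem leviCivita_extend_comm (u v : TangentSpace I p) :
    leviCivita I (FiberBundle.extend E u) p v = leviCivita I (FiberBundle.extend E v) p u := by
  have h := leviCivita_sub_swap (mdifferentiableAt_extend v) (mdifferentiableAt_extend u)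
  rw [mlieBracket_extend, FiberBundle.extend_apply_self, FiberBundle.extend_apply_self,
    sub_eq_zero] at h
  exact h

theorem trivialization_mfderiv_extend (hF : ContMDiff I I' ∞ F) (v : TangentSpace I p) {q : M}
    (hq : q ∈ (chartAt H p).source) (hq' : F q ∈ (chartAt H' (F p)).source) :
    (trivializationAt E' (TangentSpace I' : N → Type _) (F p)
      ⟨F q, mfderiv I I' F q (FiberBundle.extend E v q)⟩).2
      = fderiv ℝ (extChartAt I' (F p) ∘ F ∘ (extChartAt I p).symm) (extChartAt I p q)
        (trivializationAt E (TangentSpace I : M → Type _) p ⟨p, v⟩).2 := by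
  have hqs : q ∈ (extChartAt I p).source := by rwa [extChartAt_source]
  obtain ⟨z, hz, rfl⟩ : ∃ z ∈ (extChartAt I p).target, (extChartAt I p).symm z = q :=
    ⟨extChartAt I p q, (extChartAt I p).map_source hqs, (extChartAt I p).left_inv hqs⟩
  have h1 : MDifferentiableAt 𝓘(ℝ, E) I (extChartAt I p).symm z := by
    have := mdifferentiableWithinAt_extChartAt_symm hz
    rwa [I.range_eq_univ, mdifferentiableWithinAt_univ] at this
  have h2 : MDifferentiableAt I I' F ((extChartAt I p).symm z) :=
    hF.mdifferentiable (by simp) _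
  have h3 : MDifferentiableAt I' 𝓘(ℝ, E') (extChartAt I' (F p)) (F ((extChartAt I p).symm z)) :=
    mdifferentiableAt_extChartAt hq'
  have hc := h3.hasMFDerivAt.comp z (h2.hasMFDerivAt.comp z h1.hasMFDerivAt)
  have e1 : (FiberBundle.extend E v ((extChartAt I p).symm z) : E)
      = (mfderiv 𝓘(ℝ, E) I (extChartAt I p).symm z : E →L[ℝ] E)
        (trivializationAt E (TangentSpace I : M → Type _) p ⟨p, v⟩).2 := by
    have h5 := TangentBundle.symmL_trivializationAt (I := I) hq
    rw [I.range_eq_univ, mfderivWithin_univ] at h5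
    have h6 : ∀ z', z' = z → (mfderiv 𝓘(ℝ, E) I (extChartAt I p).symm z' : E →L[ℝ] E)
      = (mfderiv 𝓘(ℝ, E) I (extChartAt I p).symm z : E →L[ℝ] E) := by rintro z' rfl; rfl
    rw [← h6 _ ((extChartAt I p).right_inv hz)]
    change _ = (mfderiv 𝓘(ℝ, E) I (extChartAt I p).symm
      (extChartAt I p ((extChartAt I p).symm z)) : E →L[ℝ] E) _
    have h7 := congrArg (fun L : E →L[ℝ] E ↦ L
      (trivializationAt E (TangentSpace I : M → Type _) p ⟨p, v⟩).2) h5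
    refine Eq.trans ?_ h7
    exact (Trivialization.symmL_apply _ hq _).symm
  rw [(extChartAt I p).right_inv hz, ← Trivialization.continuousLinearMapAt_apply_of_mem (R := ℝ) _
    hq', TangentBundle.continuousLinearMapAt_trivializationAt hq', ← mfderiv_eq_fderiv, hc.mfderiv]
  exact congrArg (fun w : E ↦ (mfderiv I' 𝓘(ℝ, E') (extChartAt I' (F p))
    (F ((extChartAt I p).symm z)) : E' →L[ℝ] E') ((mfderiv I I' F ((extChartAt I p).symm z) :
    E →L[ℝ] E') w)) e1

/-- The second fundamental form of a map is symmetric. -/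
theorem secondFundamentalForm_comm (hF : ContMDiff I I' ∞ F) (u v : TangentSpace I p) :
    secondFundamentalForm I I' F p u v = secondFundamentalForm I I' F p v u := by
  set G : E → E' := extChartAt I' (F p) ∘ F ∘ (extChartAt I p).symm with hG
  have hGs : ContDiffAt ℝ ∞ G (extChartAt I p p) := by
    have h1 := (contMDiffAt_iff.1 (hF.contMDiffAt (x := p))).2
    rwa [I.range_eq_univ, contDiffWithinAt_univ] at h1
  have h2 : (2 : WithTop ℕ∞) ≤ ∞ := ENat.LEInfty.out
  have hsymm : IsSymmSndFDerivAt ℝ G (extChartAt I p p) :=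
    hGs.isSymmSndFDerivAt (by simpa using h2)
  have hd : DifferentiableAt ℝ (fderiv ℝ G) (extChartAt I p p) :=
    (hGs.fderiv_right (m := 1) one_add_one_le_infty).differentiableAt one_ne_zero
  let c : TangentSpace I p → E := fun v ↦
    (trivializationAt E (TangentSpace I : M → Type _) p ⟨p, v⟩).2
  have hp : p ∈ (chartAt H p).source := mem_chart_source H p
  have hc : ∀ v, (mfderiv I 𝓘(ℝ, E) (extChartAt I p) p v : E) = c v := by
    intro v
    rw [← TangentBundle.continuousLinearMapAt_trivializationAt hp]
    have h5 := Trivialization.continuousLinearMapAt_apply_of_mem (R := ℝ)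
      (trivializationAt E (TangentSpace I : M → Type _) p) hp v
    exact h5
  have key : ∀ u v : TangentSpace I p,
      mvfderiv I (fun q ↦ (trivializationAt E' (TangentSpace I' : N → Type _) (F p)
        ⟨F q, mfderiv I I' F q (FiberBundle.extend E v q)⟩).2) p u
      = fderiv ℝ (fderiv ℝ G) (extChartAt I p p) (c u) (c v) := by
    intro u v
    have hev : (fun q ↦ (trivializationAt E' (TangentSpace I' : N → Type _) (F p)
        ⟨F q, mfderiv I I' F q (FiberBundle.extend E v q)⟩).2)
        =ᶠ[𝓝 p] fun q ↦ (fun z ↦ fderiv ℝ G z (c v)) (extChartAt I p q) := by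
      filter_upwards [(chartAt H p).open_source.mem_nhds hp,
        hF.continuous.continuousAt.preimage_mem_nhds
          ((chartAt H' (F p)).open_source.mem_nhds (mem_chart_source H' (F p)))] with q hq hq'
      exact trivialization_mfderiv_extend hF v hq hq'
    have hd2 : DifferentiableAt ℝ (fun z ↦ fderiv ℝ G z (c v)) (extChartAt I p p) :=
      hd.clm_apply (differentiableAt_const _)
    have h3 := mvfderiv_comp_apply' (I := 𝓘(ℝ, E)) (g := fun z ↦ fderiv ℝ G z (c v))
      hd2.mdifferentiableAt (mdifferentiableAt_extChartAt hp) u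
    rw [mvfderiv_congr hev, h3]
    refine (congrArg (fun w : E ↦ mvfderiv 𝓘(ℝ, E) (fun z ↦ fderiv ℝ G z (c v))
      (extChartAt I p p) w) (hc u)).trans ?_
    refine (mvfderiv_eq_fderiv _ _ (c u)).trans ?_
    rw [fderiv_clm_apply hd (differentiableAt_const _)]
    simp
  have hsym := hsymm.eq (c u) (c v)
  rw [secondFundamentalForm, secondFundamentalForm, covAlong, covAlong, key, key, hsym,
    leviCivita_extend_comm, FiberBundle.extend_apply_self, FiberBundle.extend_apply_self,
    leviCivita_extend_comm u v]

theorem secondFundamentalForm_add_left (hF : ContMDiff I I' ∞ F) (u v w : TangentSpace I p) :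
    secondFundamentalForm I I' F p (u + v) w
      = secondFundamentalForm I I' F p u w + secondFundamentalForm I I' F p v w := by
  simp only [secondFundamentalForm_comm hF _ w, secondFundamentalForm_add_right hF]

theorem secondFundamentalForm_smul_left (hF : ContMDiff I I' ∞ F) (c : ℝ)
    (u v : TangentSpace I p) :
    secondFundamentalForm I I' F p (c • u) v = c • secondFundamentalForm I I' F p u v := by
  simp only [secondFundamentalForm_comm hF _ v, secondFundamentalForm_smul_right hF]

end Symmetry

end SecondFundamentalForm

section SmoothFields

variable {E : Type*} [NormedAddCommGroup E] [NormedSpace ℝ E] [FiniteDimensional ℝ E]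
  {H : Type*} [TopologicalSpace H] {I : ModelWithCorners ℝ E H}
  {M : Type*} [TopologicalSpace M] [ChartedSpace H M] [IsManifold I ∞ M]
  [RiemannianBundle (fun x : M ↦ TangentSpace I x)]
  [IsContMDiffRiemannianBundle I ∞ E (fun x : M ↦ TangentSpace I x)]
  {X Y Z : Π x : M, TangentSpace I x} {x : M}

theorem contMDiffAt_det {k : Type*} [Fintype k] [DecidableEq k] {A : M → Matrix k k ℝ}
    (hA : ∀ i j, CMDiffAt ∞ (fun y ↦ A y i j) x) : CMDiffAt ∞ (fun y ↦ (A y).det) x := by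
  simp only [Matrix.det_apply']
  exact ContMDiffAt.sum fun σ _ ↦ contMDiffAt_const.mul (ContMDiffAt.prod fun i _ ↦ hA _ _)

theorem contMDiffAt_matrix_inv {k : Type*} [Fintype k] [DecidableEq k] {A : M → Matrix k k ℝ}
    (hA : ∀ i j, CMDiffAt ∞ (fun y ↦ A y i j) x) (h0 : (A x).det ≠ 0) (i j : k) :
    CMDiffAt ∞ (fun y ↦ (A y)⁻¹ i j) x := by
  simp only [Matrix.inv_def, Ring.inverse_eq_inv', Matrix.smul_apply, smul_eq_mul,
    Matrix.adjugate_apply]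
  refine ((contMDiffAt_det hA).inv₀ h0).mul (contMDiffAt_det fun a b ↦ ?_)
  by_cases h : a = j
  · subst h
    simpa using contMDiffAt_const
  · simpa [Matrix.updateRow_ne h] using hA a b

theorem contMDiffAt_inner (hX : CMDiffAt ∞ (T% X) x) (hY : CMDiffAt ∞ (T% Y) x) :
    CMDiffAt ∞ (fun y ↦ inner ℝ (X y) (Y y)) x :=
  ContMDiffAt.inner_bundle (b := fun y : M ↦ y) hX hY

/-- A vector field is smooth if its inner products with all smooth vector fields are. -/
theorem contMDiffAt_of_inner
    (h : ∀ Z : Π x : M, TangentSpace I x, CMDiffAt ∞ (T% Z) x →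
      CMDiffAt ∞ (fun y ↦ inner ℝ (X y) (Z y)) x) : CMDiffAt ∞ (T% X) x := by
  classical
  set e := trivializationAt E (TangentSpace I : M → Type _) x
  have hx : x ∈ e.baseSet := FiberBundle.mem_baseSet_trivializationAt' x
  let b := Module.finBasis ℝ E
  have hfr := e.isLocalFrameOn_localFrame_baseSet I ∞ b
  have hs : ∀ i, CMDiffAt ∞ (T% (e.localFrame b i)) x := fun i ↦
    hfr.contMDiffAt e.open_baseSet hx i
  let G : M → Matrix _ _ ℝ := fun y ↦ Matrix.gram ℝ (fun i ↦ e.localFrame b i y)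
  have hG : ∀ i j, CMDiffAt ∞ (fun y ↦ G y i j) x := fun i j ↦ contMDiffAt_inner (hs i) (hs j)
  have hdet : ∀ y ∈ e.baseSet, (G y).det ≠ 0 := fun y hy ↦
    Matrix.det_gram_ne_zero_iff_linearIndependent.2 (hfr.linearIndependent hy)
  rw [contMDiffAt_iff_localFrameCoeff b hx]
  intro i
  have : CMDiffAt ∞ (fun y ↦ ∑ j, inner ℝ (X y) (e.localFrame b j y) * (G y)⁻¹ j i) x :=
    ContMDiffAt.sum fun j _ ↦ (h _ (hs j)).mul (contMDiffAt_matrix_inv hG (hdet x hx) j i)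
  refine this.congr_of_eventuallyEq ?_
  filter_upwards [e.open_baseSet.mem_nhds hx] with y hy
  have h1 : ∀ j, inner ℝ (X y) (e.localFrame b j y)
      = Matrix.vecMul (fun k ↦ e.localFrameCoeff I b k y (X y)) (G y) j := by
    intro j
    conv_lhs => rw [e.eq_sum_localFrameCoeff_smul (I := I) (b := b) (s := X) hy]
    simp [sum_inner, real_inner_smul_left, Matrix.vecMul, dotProduct, G]
  simp only [h1]
  change _ = Matrix.vecMul (Matrix.vecMul _ (G y)) (G y)⁻¹ i
  rw [Matrix.vecMul_vecMul, Matrix.mul_nonsing_inv _ (isUnit_iff_ne_zero.2 (hdet y hy)),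
    Matrix.vecMul_one]
  rfl

theorem contMDiffAt_mvfderiv_apply {f : M → ℝ} (hf : CMDiffAt ∞ f x) (hX : CMDiffAt ∞ (T% X) x) :
    CMDiffAt ∞ (fun y ↦ mvfderiv I f y (X y)) x := by
  have h1 : CMDiffAt ∞ (fun y ↦ (⟨f y, mfderiv I 𝓘(ℝ, ℝ) f y (X y)⟩ : TangentBundle 𝓘(ℝ, ℝ) ℝ)) x :=
    ContMDiffAt.clm_apply_of_inCoordinates (b₁ := fun y : M ↦ y) (b₂ := f)
      (hf.mfderiv_const (m := ∞) le_rfl) hX hf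
  exact ((contMDiff_snd_tangentBundle_modelSpace ℝ 𝓘(ℝ, ℝ)).contMDiffAt).comp x h1

theorem contMDiffAt_koszul (hX : CMDiffAt ∞ (T% X) x) (hY : CMDiffAt ∞ (T% Y) x)
    (hZ : CMDiffAt ∞ (T% Z) x) : CMDiffAt ∞ (koszul I X Y Z) x := by
  have : CompleteSpace E := FiniteDimensional.complete ℝ E
  have hb : ∀ {U V : Π x : M, TangentSpace I x}, CMDiffAt ∞ (T% U) x → CMDiffAt ∞ (T% V) x →
      CMDiffAt ∞ (T% (mlieBracket I U V)) x := by
    intro U V hU hV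
    have : IsManifold I (minSmoothness ℝ 2) M := by
      rw [minSmoothness_of_isRCLikeNormedField]
      infer_instance
    have : IsManifold I (((⊤ : ℕ∞) : WithTop ℕ∞) + 1) M := inferInstanceAs (IsManifold I ∞ M)
    exact ContMDiffAt.mlieBracket_vectorField (m := ⊤) (n := ⊤) hU hV (by simp)
  unfold koszul
  exact ((((((contMDiffAt_mvfderiv_apply (contMDiffAt_inner hY hZ) hX).add
    (contMDiffAt_mvfderiv_apply (contMDiffAt_inner hX hZ) hY)).sub
    (contMDiffAt_mvfderiv_apply (contMDiffAt_inner hX hY) hZ)).add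
    (contMDiffAt_inner (hb hX hY) hZ)).sub (contMDiffAt_inner (hb hX hZ) hY)).sub
    (contMDiffAt_inner (hb hY hZ) hX)).div_const 2

theorem eventually_mdifferentiableAt (hX : CMDiffAt ∞ (T% X) x) :
    ∀ᶠ y in 𝓝 x, MDiffAt (T% X) y := by
  have h : CMDiffAt 1 (T% X) x := hX.of_le ENat.LEInfty.out
  filter_upwards [(contMDiffAt_iff_contMDiffAt_nhds (by simp)).1 h]
    with y hy using hy.mdifferentiableAt one_ne_zero

theorem contMDiffAt_leviCivita (hX : CMDiffAt ∞ (T% X) x) (hY : CMDiffAt ∞ (T% Y) x) :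
    CMDiffAt ∞ (T% (fun y ↦ leviCivita I Y y (X y))) x := by
  refine contMDiffAt_of_inner fun Z hZ ↦ ?_
  refine (contMDiffAt_koszul hX hY hZ).congr_of_eventuallyEq ?_
  filter_upwards [eventually_mdifferentiableAt hX, eventually_mdifferentiableAt hY,
    eventually_mdifferentiableAt hZ] with y h1 h2 h3 using inner_leviCivita h1 h2 h3

end SmoothFields

section Geodesics

variable {E : Type*} [NormedAddCommGroup E] [NormedSpace ℝ E] [FiniteDimensional ℝ E]
  {H : Type*} [TopologicalSpace H] {I : ModelWithCorners ℝ E H}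
  {M : Type*} [TopologicalSpace M] [ChartedSpace H M] [IsManifold I ∞ M]
  [RiemannianBundle (fun x : M ↦ TangentSpace I x)]
  [IsContMDiffRiemannianBundle I ∞ E (fun x : M ↦ TangentSpace I x)]

theorem covAlong_sum {E' : Type*} [NormedAddCommGroup E'] [NormedSpace ℝ E']
    {H' : Type*} [TopologicalSpace H'] {I' : ModelWithCorners ℝ E' H'}
    {B : Type*} [TopologicalSpace B] [ChartedSpace H' B]
    {f : B → M} {p : B} {u : TangentSpace I' p} {ι : Type*} (t : Finset ι)
    {S : ι → Π q : B, TangentSpace I (f q)}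
    (hf : MDiffAt f p) (hS : ∀ i ∈ t, MDiffAlongAt I I' f (S i) p) :
    covAlong I I' f (fun q ↦ ∑ i ∈ t, S i q) p u = ∑ i ∈ t, covAlong I I' f (S i) p u := by
  classical
  induction t using Finset.induction_on with
  | empty =>
    have h := covAlong_comp (I := I) (I' := I') (u := u) hf
      (Y := (0 : Π x : M, TangentSpace I x)) (mdifferentiableAt_zeroSection ..)
    simpa using h.trans (leviCivita_zero _)
  | insert i t hi ih =>
    have hS' := fun j hj ↦ hS j (Finset.mem_insert_of_mem hj)
    simp only [Finset.sum_insert hi]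
    rw [covAlong_add (hS i (Finset.mem_insert_self i t)) (MDiffAlongAt.sum t hf hS'), ih hS']

/-- The Christoffel symbols of the connection in the frame given by the trivialization
of the tangent bundle at `x`. -/
noncomputable def christoffel (I : ModelWithCorners ℝ E H) [IsManifold I ∞ M]
    [RiemannianBundle (fun x : M ↦ TangentSpace I x)]
    {ι : Type*} (b : Module.Basis ι ℝ E) (x : M) (i j k : ι) (y : M) : ℝ :=
  let e := trivializationAt E (TangentSpace I : M → Type _) x
  e.localFrameCoeff I b k y (leviCivita I (e.localFrame b j) y (e.localFrame b i y))

variable {ι : Type*} [Fintype ι] (b : Module.Basis ι ℝ E) {x y : M}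

theorem contMDiffAt_christoffel
    (hy : y ∈ (trivializationAt E (TangentSpace I : M → Type _) x).baseSet) (i j k : ι) :
    CMDiffAt ∞ (christoffel I b x i j k) y :=
  (contMDiffAt_iff_localFrameCoeff b hy).1 (contMDiffAt_leviCivita
    (contMDiffAt_localFrame_of_mem ∞ _ b i hy) (contMDiffAt_localFrame_of_mem ∞ _ b j hy)) k

theorem covAlong_velocity_eq_zero {β : ℝ → M} {w : ι → ℝ → ℝ} {t : ℝ} (hβ : MDiffAt β t)
    (hy : β t ∈ (trivializationAt E (TangentSpace I : M → Type _) x).baseSet)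
    (hw : ∀ k, HasDerivAt (w k) (-∑ i, ∑ j, w i t * w j t * christoffel I b x i j k (β t)) t)
    (hv : ∀ᶠ r in 𝓝 t, velocity I β r = ∑ i, w i r •
      (trivializationAt E (TangentSpace I : M → Type _) x).localFrame b i (β r)) :
    covAlong I 𝓘(ℝ, ℝ) β (velocity I β) t (1 : ℝ) = 0 := by
  obtain ⟨u, hu⟩ : ∃ u : TangentSpace 𝓘(ℝ, ℝ) t, u = (1 : ℝ) := ⟨_, rfl⟩
  suffices covAlong I 𝓘(ℝ, ℝ) β (velocity I β) t u = 0 by rw [hu] at this; exact this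
  set e := trivializationAt E (TangentSpace I : M → Type _) x
  have hs : ∀ i, MDiffAt (T% (e.localFrame b i)) (β t) := fun i ↦
    (contMDiffAt_localFrame_of_mem 1 e b i hy).mdifferentiableAt one_ne_zero
  have hws : ∀ i, MDiffAt (w i) t := fun i ↦ (hw i).differentiableAt.mdifferentiableAt
  have hdw : ∀ k, mvfderiv 𝓘(ℝ, ℝ) (w k) t u
      = -∑ i, ∑ j, w i t * w j t * christoffel I b x i j k (β t) := fun k ↦ by
    rw [hu]
    exact (mvfderiv_eq_fderiv _ _ _).trans (by simpa using (hw k).deriv)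
  have hLC : ∀ j, leviCivita I (e.localFrame b j) (β t) (mfderiv 𝓘(ℝ, ℝ) I β t u)
      = ∑ i, w i t • ∑ k, christoffel I b x i j k (β t) • e.localFrame b k (β t) := by
    intro j
    have h1 : mfderiv 𝓘(ℝ, ℝ) I β t u = ∑ i, w i t • e.localFrame b i (β t) := by
      rw [hu]
      exact hv.self_of_nhds
    have h2 := congrArg (leviCivitaHom (hs j)) h1
    rw [map_sum] at h2
    refine h2.trans (Finset.sum_congr rfl fun i _ ↦ ?_)
    rw [map_smul]
    congr 1
    exact e.eq_sum_localFrameCoeff_smul (I := I) (b := b)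
      (s := fun y ↦ leviCivita I (e.localFrame b j) y (e.localFrame b i y)) hy
  rw [covAlong_congr hv, covAlong_sum _ hβ fun i _ ↦ (mdiffAlongAt_comp hβ (hs i)).smul (hws i)]
  have h3 : ∀ j, covAlong I 𝓘(ℝ, ℝ) β (fun q ↦ w j q • e.localFrame b j (β q)) t u
      = w j t • (∑ i, w i t • ∑ k, christoffel I b x i j k (β t) • e.localFrame b k (β t))
        + (-∑ i, ∑ l, w i t * w l t * christoffel I b x i l j (β t)) • e.localFrame b j (β t) := by
    intro j
    rw [covAlong_smul (hws j) (mdiffAlongAt_comp hβ (hs j)), covAlong_comp hβ (hs j), hLC, ← hdw j]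
  simp only [h3, Finset.sum_add_distrib, neg_smul, Finset.sum_neg_distrib, add_neg_eq_zero,
    Finset.smul_sum, Finset.sum_smul, smul_smul]
  rw [Finset.sum_comm, Finset.sum_comm (s := Finset.univ) (t := Finset.univ)
    (f := fun k i ↦ ∑ l, (w i t * w l t * christoffel I b x i l k (β t)) • e.localFrame b k (β t))]
  refine Finset.sum_congr rfl fun i _ ↦ Eq.trans ?_ Finset.sum_comm
  refine Finset.sum_congr rfl fun j _ ↦ Finset.sum_congr rfl fun k _ ↦ ?_
  rw [← mul_assoc, mul_comm (w j t)]

variable (I) in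
/-- The first order system of the geodesic equation in the chart at `x`. -/
noncomputable def geodesicSystem (x : M) (z : E × (ι → ℝ)) : E × (ι → ℝ) :=
  (∑ i, z.2 i • b i,
    fun k ↦ -∑ i, ∑ j, z.2 i * z.2 j * christoffel I b x i j k ((extChartAt I x).symm z.1))

theorem mem_baseSet_extChartAt_symm {z : E} (hz : z ∈ (extChartAt I x).target) :
    (extChartAt I x).symm z ∈ (trivializationAt E (TangentSpace I : M → Type _) x).baseSet := by
  rw [TangentBundle.trivializationAt_baseSet, ← extChartAt_source I]
  exact (extChartAt I x).map_target hz

variable [I.Boundaryless]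

theorem contDiffAt_geodesicSystem {z : E × (ι → ℝ)} (hz : z.1 ∈ (extChartAt I x).target) :
    ContDiffAt ℝ ∞ (geodesicSystem I b x) z := by
  have h1 : ∀ i, ContDiffAt ℝ ∞ (fun z : E × (ι → ℝ) ↦ z.2 i) z := fun i ↦
    ((contDiff_apply ℝ ℝ i).comp contDiff_snd).contDiffAt
  have h2 : ∀ i j k, ContDiffAt ℝ ∞ (fun z : E × (ι → ℝ) ↦
      christoffel I b x i j k ((extChartAt I x).symm z.1)) z := by
    intro i j k
    have h3 : ContDiffAt ℝ ∞ (fun z : E ↦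
        christoffel I b x i j k ((extChartAt I x).symm z)) z.1 := by
      rw [← contMDiffAt_iff_contDiffAt]
      exact (contMDiffAt_christoffel b (mem_baseSet_extChartAt_symm hz) i j k).comp z.1
        ((contMDiffOn_extChartAt_symm x).contMDiffAt ((isOpen_extChartAt_target x).mem_nhds hz))
    exact h3.comp z contDiffAt_fst
  refine (ContDiffAt.sum fun i _ ↦ (h1 i).smul contDiffAt_const).prodMk (contDiffAt_pi.2 fun k ↦ ?_)
  exact (ContDiffAt.sum fun i _ ↦ ContDiffAt.sum fun j _ ↦ ((h1 i).mul (h1 j)).mul (h2 i j k)).neg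

theorem contDiffOn_of_hasDerivAt {V : Type*} [NormedAddCommGroup V] [NormedSpace ℝ V]
    {f : V → V} {γ : ℝ → V} {s : Set ℝ} (hs : IsOpen s)
    (hγ : ∀ t ∈ s, HasDerivAt γ (f (γ t)) t) (hf : ∀ t ∈ s, ContDiffAt ℝ ∞ f (γ t)) :
    ContDiffOn ℝ ∞ γ s := by
  have hd : DifferentiableOn ℝ γ s := fun t ht ↦ (hγ t ht).differentiableAt.differentiableWithinAt
  refine contDiffOn_infty.2 fun n ↦ ?_
  induction n with
  | zero => exact contDiffOn_zero.2 hd.continuousOn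
  | succ n ih =>
    push_cast
    refine (contDiffOn_succ_iff_deriv_of_isOpen hs).2 ⟨hd, by simp, ?_⟩
    have h : ContDiffOn ℝ n (f ∘ γ) s := fun t ht ↦
      ((hf t ht).of_le (by exact_mod_cast le_top)).comp_contDiffWithinAt t (ih t ht)
    exact h.congr fun t ht ↦ (hγ t ht).deriv

theorem mfderiv_extChartAt_symm_apply {z : E} (hz : z ∈ (extChartAt I x).target) (w : ι → ℝ) :
    mfderiv 𝓘(ℝ, E) I (extChartAt I x).symm z (∑ i, w i • b i : E)
      = ∑ i, w i • (trivializationAt E (TangentSpace I : M → Type _) x).localFrame b i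
        ((extChartAt I x).symm z) := by
  set e := trivializationAt E (TangentSpace I : M → Type _) x
  have hy := mem_baseSet_extChartAt_symm hz
  have h1 : e.symmL ℝ ((extChartAt I x).symm z) (∑ i, w i • b i : E)
      = ∑ i, w i • e.localFrame b i ((extChartAt I x).symm z) := by
    rw [map_sum]
    refine Finset.sum_congr rfl fun i _ ↦ ?_
    rw [map_smul, e.localFrame_apply_of_mem_baseSet b hy, Trivialization.basisAt,
      Module.Basis.map_apply, Trivialization.symmL_apply _ hy, Trivialization.linearEquivAt_symm_apply]
  have hs : (extChartAt I x).symm z ∈ (chartAt H x).source := by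
    rw [← extChartAt_source I]
    exact (extChartAt I x).map_target hz
  rw [← h1, TangentBundle.symmL_trivializationAt hs, (extChartAt I x).right_inv hz,
    I.range_eq_univ, mfderivWithin_univ]
  rfl

/-- Local existence of geodesics with given initial velocity. -/
theorem exists_isGeodesicOn (Z : TangentSpace I x) {W : Set M} (hW : W ∈ 𝓝 x) :
    ∃ (ε : ℝ) (β : ℝ → M), 0 < ε ∧ IsGeodesicOn I β (-ε) ε ∧
      (∀ t ∈ Set.Ioo (-ε) ε, β t ∈ W) ∧
      (⟨β 0, velocity I β 0⟩ : TangentBundle I M) = ⟨x, Z⟩ := by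
  have : CompleteSpace E := FiniteDimensional.complete ℝ E
  let b := Module.finBasis ℝ E
  set e := trivializationAt E (TangentSpace I : M → Type _) x
  have hx : x ∈ e.baseSet := FiberBundle.mem_baseSet_trivializationAt' x
  let φ := extChartAt I x
  let w₀ := (b.repr (e ⟨x, Z⟩).2 : _ → ℝ)
  obtain ⟨γ, h0, ε₁, hε₁, hγ⟩ := ((contDiffAt_geodesicSystem b (z := (φ x, w₀))
    (mem_extChartAt_target x)).of_le
    ENat.LEInfty.out).exists_forall_mem_closedBall_exists_eq_forall_mem_Ioo_hasDerivAt₀ 0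
  have hcont : ContinuousAt γ 0 := (hγ 0 (by simpa using hε₁)).continuousAt
  have hmem : ∀ᶠ t in 𝓝 (0 : ℝ), (γ t).1 ∈ φ.target ∧ φ.symm (γ t).1 ∈ W := by
    have h1 : Tendsto (fun t ↦ (γ t).1) (𝓝 0) (𝓝 (φ x)) := by
      have := (continuous_fst.continuousAt.comp hcont).tendsto
      rwa [Function.comp_apply, h0] at this
    have h2 : ∀ᶠ z in 𝓝 (φ x), z ∈ φ.target :=
      (isOpen_extChartAt_target x).mem_nhds (mem_extChartAt_target x)
    refine (h1.eventually h2).and (h1.eventually (p := fun z ↦ φ.symm z ∈ W) ?_)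
    refine (continuousAt_extChartAt_symm x).tendsto.eventually_mem ?_
    rwa [extChartAt_to_inv]
  obtain ⟨ε₂, hε₂, hmem⟩ := Metric.eventually_nhds_iff.1 hmem
  let ε := min ε₁ ε₂
  have hε : 0 < ε := lt_min hε₁ hε₂
  have hγ' : ∀ t ∈ Set.Ioo (-ε) ε, HasDerivAt γ (geodesicSystem I b x (γ t)) t := fun t ht ↦
    hγ t ⟨by linarith [ht.1, min_le_left ε₁ ε₂], by linarith [ht.2, min_le_left ε₁ ε₂]⟩
  have hm : ∀ t ∈ Set.Ioo (-ε) ε, (γ t).1 ∈ φ.target ∧ φ.symm (γ t).1 ∈ W := fun t ht ↦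
    hmem (by rw [Real.dist_eq, sub_zero, abs_lt]
             exact ⟨by linarith [ht.1, min_le_right ε₁ ε₂], by linarith [ht.2, min_le_right ε₁ ε₂]⟩)
  have hsm : ContDiffOn ℝ ∞ γ (Set.Ioo (-ε) ε) := contDiffOn_of_hasDerivAt isOpen_Ioo hγ'
    fun t ht ↦ contDiffAt_geodesicSystem b (hm t ht).1
  let β : ℝ → M := fun t ↦ φ.symm (γ t).1
  have hβ : ContMDiffOn 𝓘(ℝ, ℝ) I ∞ β (Set.Ioo (-ε) ε) :=
    (contMDiffOn_extChartAt_symm x).comp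
      (contMDiffOn_iff_contDiffOn.2 (contDiff_fst.comp_contDiffOn hsm)) fun t ht ↦ (hm t ht).1
  have hvel : ∀ t ∈ Set.Ioo (-ε) ε,
      velocity I β t = ∑ i, (γ t).2 i • e.localFrame b i (β t) := by
    intro t ht
    have h1 : HasMFDerivAt 𝓘(ℝ, E) I φ.symm (γ t).1 (mfderiv 𝓘(ℝ, E) I φ.symm (γ t).1) :=
      (((contMDiffOn_extChartAt_symm (n := ∞) x).contMDiffAt
        ((isOpen_extChartAt_target x).mem_nhds (hm t ht).1)).mdifferentiableAt
        (by simp)).hasMFDerivAt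
    have h2 : HasDerivAt (fun t ↦ (γ t).1) (∑ i, (γ t).2 i • b i) t := (hγ' t ht).fst
    have h3 := h1.comp t h2.hasFDerivAt.hasMFDerivAt
    rw [← mfderiv_extChartAt_symm_apply b (hm t ht).1]
    refine (congrArg (fun L ↦ L (1 : ℝ)) h3.mfderiv).trans ?_
    exact congrArg (mfderiv 𝓘(ℝ, E) I φ.symm (γ t).1) (one_smul ℝ (∑ i, (γ t).2 i • b i))
  refine ⟨ε, β, hε, ⟨hβ, fun t ht ↦ ?_⟩, fun t ht ↦ (hm t ht).2, ?_⟩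
  · have hnhds : Set.Ioo (-ε) ε ∈ 𝓝 t := isOpen_Ioo.mem_nhds ht
    refine covAlong_velocity_eq_zero b (x := x) (w := fun i t ↦ (γ t).2 i)
      ((hβ.contMDiffAt hnhds).mdifferentiableAt (by simp))
      (mem_baseSet_extChartAt_symm (hm t ht).1) (fun k ↦ ?_) ?_
    · exact hasDerivAt_pi.1 (hγ' t ht).snd k
    · filter_upwards [hnhds] with r hr using hvel r hr
  · have hm0 : (0 : ℝ) ∈ Set.Ioo (-ε) ε := by simpa using hε
    have hβ0 : β 0 = x := by
      change φ.symm (γ 0).1 = x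
      rw [h0]
      exact extChartAt_to_inv x
    rw [hvel 0 hm0, h0, hβ0]
    congr 1
    have h1 : ∀ i, e.localFrame b i x = e.symm x (b i) := fun i ↦ by
      rw [e.localFrame_apply_of_mem_baseSet b hx, Trivialization.basisAt,
        Module.Basis.map_apply, Trivialization.linearEquivAt_symm_apply]
    have h2 := map_sum (e.symmL ℝ x) (fun i ↦ w₀ i • b i) Finset.univ
    have h3 : ∀ i, e.symm x (w₀ i • b i) = w₀ i • e.symm x (b i) := fun i ↦
      trivialization_symm_smul hx _ _
    simp only [Trivialization.symmL_apply _ hx, h3] at h2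
    simp only [h1]
    refine h2.symm.trans ?_
    rw [b.sum_repr]
    exact Trivialization.symm_apply_apply_mk _ hx Z

end Geodesics

theorem sin_angle_sq_mul {V : Type*} [NormedAddCommGroup V] [InnerProductSpace ℝ V]
    (D : Submodule ℝ V) [D.HasOrthogonalProjection] (Z : V) :
    Real.sin (InnerProductGeometry.angle Z (Dᗮ.starProjection Z)) ^ 2 * inner ℝ Z Z
      = inner ℝ (D.starProjection Z) Z := by
  have h1 : inner ℝ (D.starProjection Z) Z = inner ℝ Z Z - inner ℝ Z (Dᗮ.starProjection Z) := by
    rw [← inner_sub_right, Submodule.starProjection_orthogonal_val, sub_sub_cancel, real_inner_comm]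
  have h2 : inner ℝ Z (Dᗮ.starProjection Z)
      = ‖Dᗮ.starProjection Z‖ ^ 2 := by
    rw [← real_inner_self_eq_norm_sq, Submodule.inner_starProjection_left_eq_right,
      Submodule.starProjection_eq_self_iff.2 (Submodule.starProjection_apply_mem _ _)]
  have h3 := InnerProductGeometry.cos_angle_mul_norm_mul_norm Z (Dᗮ.starProjection Z)
  rw [Real.sin_sq, h1, h2, real_inner_self_eq_norm_sq, sub_mul, one_mul]
  by_cases h0 : ‖Dᗮ.starProjection Z‖ = 0
  · have : Dᗮ.starProjection Z = 0 := norm_eq_zero.1 h0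
    simp [this]
  · rw [h2] at h3
    have : Real.cos (InnerProductGeometry.angle Z (Dᗮ.starProjection Z)) * ‖Z‖
        = ‖Dᗮ.starProjection Z‖ := by
      apply mul_right_cancel₀ h0
      rw [mul_assoc, h3, sq]
    rw [← mul_pow, this]

section Clairaut

variable {E : Type*} [NormedAddCommGroup E] [NormedSpace ℝ E] [FiniteDimensional ℝ E]
  {H : Type*} [TopologicalSpace H] {I : ModelWithCorners ℝ E H}
  {M : Type*} [TopologicalSpace M] [ChartedSpace H M] [IsManifold I ∞ M]
  [RiemannianBundle (fun x : M ↦ TangentSpace I x)]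
  [IsContMDiffRiemannianBundle I ∞ E (fun x : M ↦ TangentSpace I x)]
  {A : Π y : M, TangentSpace I y →L[ℝ] TangentSpace I y} {x : M}

theorem inner_covEnd_comm (hA : MDiffEndAt I A x)
    (hs : ∀ y (v w : TangentSpace I y), inner ℝ (A y v) w = inner ℝ v (A y w))
    (u v w : TangentSpace I x) :
    inner ℝ (covEnd I A x u v) w = inner ℝ v (covEnd I A x u w) := by
  have hv := mdifferentiableAt_extend v
  have hw := mdifferentiableAt_extend w
  have h1 := mvfderiv_inner (hA.apply hv) hw u
  have h2 := mvfderiv_inner hv (hA.apply hw) u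
  simp only [hs] at h1
  rw [h2, leviCivita_apply hA hv, leviCivita_apply hA hw, inner_add_left, inner_add_right,
    hs x (leviCivita I (FiberBundle.extend E v) x u), FiberBundle.extend_apply_self,
    FiberBundle.extend_apply_self] at h1
  linarith

theorem covEnd_idempotent (hA : MDiffEndAt I A x)
    (hs : ∀ y (v : TangentSpace I y), A y (A y v) = A y v) (u v : TangentSpace I x) :
    covEnd I A x u (A x v) + A x (covEnd I A x u v) = covEnd I A x u v := by
  have hv := mdifferentiableAt_extend v
  have h1 := leviCivita_apply hA (hA.apply hv) u
  simp only [hs] at h1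
  rw [leviCivita_apply hA hv, map_add, hs, FiberBundle.extend_apply_self] at h1
  apply add_right_cancel (b := A x (leviCivita I (FiberBundle.extend E v) x u))
  rw [h1, add_assoc]

theorem mdiffAlongAt_velocity {β : ℝ → M} {t : ℝ} (hβ : ContMDiffAt 𝓘(ℝ, ℝ) I ∞ β t) :
    MDiffAlongAt I 𝓘(ℝ, ℝ) β (velocity I β) t := by
  have h1 : ContMDiffAt 𝓘(ℝ, ℝ) 𝓘(ℝ, ℝ).tangent ∞
      (fun t : ℝ ↦ (⟨t, (1 : ℝ)⟩ : TangentBundle 𝓘(ℝ, ℝ) ℝ)) t :=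
    contMDiffAt_vectorSpace_iff_contDiffAt.2 contDiffAt_const
  have h2 : ContMDiffAt 𝓘(ℝ, ℝ) I.tangent ∞
      (fun t ↦ (⟨β t, velocity I β t⟩ : TangentBundle I M)) t :=
    ContMDiffAt.clm_apply_of_inCoordinates (b₁ := fun t : ℝ ↦ t) (b₂ := β)
      (hβ.mfderiv_const (m := ∞) le_rfl) h1 hβ
  exact h2.mdifferentiableAt (by simp)

variable [I.Boundaryless] {D : Π y : M, Submodule ℝ (TangentSpace I y)} {W : Set M} {g : M → ℝ}

theorem clairaut_deriv (hW : IsOpen W) (hD : IsSmoothDistributionOn I D W) (hx : x ∈ W)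
    (hg : MDiffAt g x)
    (hC : ∀ (β : ℝ → M) (a b : ℝ), IsGeodesicOn I β a b → (∀ t ∈ Set.Ioo a b, β t ∈ W) →
        ∃ c : ℝ, ∀ t ∈ Set.Ioo a b,
          Real.exp (g (β t)) * Real.sin (InnerProductGeometry.angle (velocity I β t)
            ((D (β t))ᗮ.starProjection (velocity I β t))) = c) (Z : TangentSpace I x) :
    2 * mvfderiv I g x Z * inner ℝ ((D x).starProjection Z) Z
      + inner ℝ (covEnd I (fun y ↦ (D y).starProjection) x Z Z) Z = 0 := by
  obtain ⟨ε, β, hε, hβ, hβW, h0⟩ := exists_isGeodesicOn Z (hW.mem_nhds hx)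
  obtain ⟨c, hc⟩ := hC β _ _ hβ hβW
  have hm0 : (0 : ℝ) ∈ Set.Ioo (-ε) ε := by simpa using hε
  have hnhds : Set.Ioo (-ε) ε ∈ 𝓝 (0 : ℝ) := isOpen_Ioo.mem_nhds hm0
  have hgeo := hβ.2 0 hm0
  have hβ0 : ContMDiffAt 𝓘(ℝ, ℝ) I ∞ β 0 := hβ.1.contMDiffAt hnhds
  have hvel := mdiffAlongAt_velocity hβ0
  cases h0
  obtain ⟨u, hu⟩ : ∃ u : TangentSpace 𝓘(ℝ, ℝ) (0 : ℝ), u = (1 : ℝ) := ⟨_, rfl⟩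
  have hgeo' : covAlong I 𝓘(ℝ, ℝ) β (velocity I β) 0 u = 0 := by rw [hu]; exact hgeo
  have hvel0 : mfderiv 𝓘(ℝ, ℝ) I β 0 u = velocity I β 0 := by rw [hu]; rfl
  have hP : MDiffEndAt I (fun y ↦ (D y).starProjection) (β 0) := hD.mdiffEndAt hW hx
  have hPv := hP.apply_along hvel
  have hd1 := mvfderiv_inner_along (u := u) hPv hvel
  have hd2 := mvfderiv_inner_along (u := u) hvel hvel
  rw [covAlong_apply hP hvel, hgeo', map_zero, add_zero, inner_zero_right, add_zero, hvel0] at hd1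
  rw [hgeo', inner_zero_left, inner_zero_right, add_zero] at hd2
  have hgβ : MDiffAt (fun t ↦ g (β t)) (0 : ℝ) := hg.comp _ (hβ0.mdifferentiableAt (by simp))
  have hdg : mvfderiv 𝓘(ℝ, ℝ) (fun t ↦ g (β t)) 0 u = mvfderiv I g (β 0) (velocity I β 0) := by
    rw [mvfderiv_comp_apply' hg (hβ0.mdifferentiableAt (by simp)), hvel0]
  have heq : (fun t ↦ inner ℝ ((D (β t)).starProjection (velocity I β t)) (velocity I β t))
      =ᶠ[𝓝 0] fun t ↦ Real.exp (-2 * g (β t)) *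
        (c ^ 2 * inner ℝ (velocity I β t) (velocity I β t)) := by
    filter_upwards [hnhds] with t ht
    rw [← hc t ht, mul_pow, mul_assoc, sin_angle_sq_mul, ← mul_assoc, ← Real.exp_nat_mul,
      ← Real.exp_add]
    simp
  have hder : ∀ {k : ℝ → ℝ}, MDiffAt k (0 : ℝ) → HasDerivAt k (mvfderiv 𝓘(ℝ, ℝ) k 0 u) 0 := by
    intro k hk
    have h1 : mvfderiv 𝓘(ℝ, ℝ) k 0 u = deriv k 0 := by
      rw [hu]
      exact (mvfderiv_eq_fderiv k 0 (1 : ℝ)).trans fderiv_apply_one_eq_deriv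
    rw [h1]
    exact hk.differentiableAt.hasDerivAt
  have e1 := hder (mdifferentiableAt_inner_along hPv hvel)
  have e2 := hder (mdifferentiableAt_inner_along hvel hvel)
  have e3 := ((hder hgβ).const_mul (-2)).exp.mul (e2.const_mul (c ^ 2))
  have e4 := (e1.congr_of_eventuallyEq heq.symm).unique e3
  rw [hd1, hd2, hdg, mul_zero, mul_zero, add_zero] at e4
  have e5 := heq.self_of_nhds
  simp only at e5
  rw [e4, e5]
  ring

theorem inner_covEnd_of_clairaut (hW : IsOpen W) (hD : IsSmoothDistributionOn I D W) (hx : x ∈ W)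
    (hg : MDiffAt g x)
    (hC : ∀ (β : ℝ → M) (a b : ℝ), IsGeodesicOn I β a b → (∀ t ∈ Set.Ioo a b, β t ∈ W) →
        ∃ c : ℝ, ∀ t ∈ Set.Ioo a b,
          Real.exp (g (β t)) * Real.sin (InnerProductGeometry.angle (velocity I β t)
            ((D (β t))ᗮ.starProjection (velocity I β t))) = c)
    {X V : TangentSpace I x} (hX : X ∈ D x) (hV : V ∈ (D x)ᗮ) :
    inner ℝ (covEnd I (fun y ↦ (D y).starProjection) x X X) V
      = -(mvfderiv I g x V * inner ℝ X X) := by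
  set P : Π y : M, TangentSpace I y →L[ℝ] TangentSpace I y := fun y ↦ (D y).starProjection
  have hP : MDiffEndAt I P x := hD.mdiffEndAt hW hx
  have hs : ∀ y (v w : TangentSpace I y), inner ℝ (P y v) w = inner ℝ v (P y w) := fun y v w ↦
    Submodule.inner_starProjection_left_eq_right _ _ _
  have hid : ∀ y (v : TangentSpace I y), P y (P y v) = P y v := fun y v ↦
    Submodule.starProjection_eq_self_iff.2 (Submodule.starProjection_apply_mem _ _)
  have hPX : P x X = X := Submodule.starProjection_eq_self_iff.2 hX
  have hP0 : ∀ {V}, V ∈ (D x)ᗮ → P x V = 0 := fun hV ↦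
    (Submodule.starProjection_apply_eq_zero_iff _).2 hV
  have hXX : ∀ u, inner ℝ (covEnd I P x u X) X = 0 := by
    intro u
    have h := covEnd_idempotent hP hid u X
    rw [hPX, add_eq_left] at h
    rw [← hPX, ← hs, hPX, h, inner_zero_left]
  have hVV : ∀ u {V}, V ∈ (D x)ᗮ → inner ℝ (covEnd I P x u V) V = 0 := by
    intro u V hV
    have h := covEnd_idempotent hP hid u V
    have h0 : covEnd I P x u (0 : TangentSpace I x) = 0 := by
      have := covEnd_add_right hP u 0 0
      rwa [add_zero, left_eq_add] at this
    rw [hP0 hV, h0, zero_add] at h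
    rw [← h, hs, hP0 hV, inner_zero_right]
  have key : ∀ {V}, V ∈ (D x)ᗮ →
      (mvfderiv I g x X + mvfderiv I g x V) * inner ℝ X X
        + inner ℝ (covEnd I P x X X) V + inner ℝ (covEnd I P x V X) V = 0 := by
    intro V hV
    have h := clairaut_deriv hW hD hx hg hC (X + V)
    have hXV : inner ℝ X V = 0 := hV X hX
    change 2 * mvfderiv I g x (X + V) * inner ℝ (P x (X + V)) (X + V)
      + inner ℝ (covEnd I P x (X + V) (X + V)) (X + V) = 0 at h
    rw [map_add, map_add, hPX, hP0 hV, add_zero, covEnd_add_right hP, covEnd_add_left hP,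
      covEnd_add_left hP] at h
    simp only [inner_add_left, inner_add_right, hXX, hVV _ hV, hXV] at h
    rw [inner_covEnd_comm hP hs X V X, inner_covEnd_comm hP hs V V X, real_inner_comm _ V,
      real_inner_comm _ V] at h
    linarith
  have h1 := key hV
  have h2 := key (Submodule.neg_mem _ hV)
  have h3 : covEnd I P x (-V) X = -covEnd I P x V X := by
    have := covEnd_smul_left hP (-1) V X
    rwa [neg_one_smul, neg_one_smul] at this
  rw [h3, map_neg, inner_neg_neg, inner_neg_right] at h2
  linarith

end Clairaut

section Kahler

variable {E : Type*} [NormedAddCommGroup E] [NormedSpace ℝ E] [FiniteDimensional ℝ E]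
  {H : Type*} [TopologicalSpace H] {I : ModelWithCorners ℝ E H}
  {M : Type*} [TopologicalSpace M] [ChartedSpace H M] [IsManifold I ∞ M]
  [RiemannianBundle (fun x : M ↦ TangentSpace I x)]
  [IsContMDiffRiemannianBundle I ∞ E (fun x : M ↦ TangentSpace I x)]
  {J : Π y : M, TangentSpace I y →L[ℝ] TangentSpace I y}

theorem contMDiffAt_extend {x : M} (v : TangentSpace I x) :
    CMDiffAt ∞ (T% (FiberBundle.extend E v : Π y : M, TangentSpace I y)) x :=
  FiberBundle.contMDiffAt_extend ..

theorem IsKahler.mdiffEndAt (hJ : IsKahler I J) (x : M) : MDiffEndAt I J x :=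
  hJ.smooth.mdiffEndAt isOpen_univ (Set.mem_univ x)

theorem IsKahler.covEnd_eq_zero (hJ : IsKahler I J) {x : M} (v w : TangentSpace I x) :
    covEnd I J x v w = 0 := by
  have h1 := leviCivita_apply (hJ.mdiffEndAt x) (mdifferentiableAt_extend w) v
  rwa [hJ.parallel _ x v (contMDiffAt_extend w), right_eq_add, FiberBundle.extend_apply_self] at h1

theorem IsKahler.inner_left (hJ : IsKahler I J) {x : M} (v w : TangentSpace I x) :
    inner ℝ (J x v) w = -inner ℝ v (J x w) := by
  rw [← hJ.isometry x v (J x w), hJ.sq, inner_neg_right, neg_neg]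

end Kahler

section Maps

variable {E : Type*} [NormedAddCommGroup E] [NormedSpace ℝ E] [FiniteDimensional ℝ E]
  {H : Type*} [TopologicalSpace H] {I : ModelWithCorners ℝ E H}
  {M : Type*} [TopologicalSpace M] [ChartedSpace H M] [IsManifold I ∞ M]
  [RiemannianBundle (fun x : M ↦ TangentSpace I x)]
  [IsContMDiffRiemannianBundle I ∞ E (fun x : M ↦ TangentSpace I x)]
  {E' : Type*} [NormedAddCommGroup E'] [NormedSpace ℝ E'] [FiniteDimensional ℝ E']
  {H' : Type*} [TopologicalSpace H'] {I' : ModelWithCorners ℝ E' H'}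
  {N : Type*} [TopologicalSpace N] [ChartedSpace H' N] [IsManifold I' ∞ N]
  [RiemannianBundle (fun x : N ↦ TangentSpace I' x)]
  [IsContMDiffRiemannianBundle I' ∞ E' (fun x : N ↦ TangentSpace I' x)]
  {F : M → N} {p : M} {J : Π y : N, TangentSpace I' y →L[ℝ] TangentSpace I' y} {g : N → ℝ}

theorem mfderiv_mem_rangeD (v : TangentSpace I p) : mfderiv I I' F p v ∈ rangeD I I' F p :=
  ⟨v, rfl⟩

theorem IsLagrangian.inner_eq_zero (hL : IsLagrangian I I' F J) (v w : TangentSpace I p) :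
    inner ℝ (mfderiv I I' F p v) (J (F p) (mfderiv I I' F p w)) = 0 :=
  hL.antiInvariant p ⟨_, mfderiv_mem_rangeD w, rfl⟩ _ (mfderiv_mem_rangeD v)

theorem inner_secondFundamentalForm_comm_of_isLagrangian (hF : ContMDiff I I' ∞ F)
    (hJ : IsKahler I' J) (hL : IsLagrangian I I' F J) (x y z : TangentSpace I p) :
    inner ℝ (secondFundamentalForm I I' F p x y) (J (F p) (mfderiv I I' F p z))
      = inner ℝ (secondFundamentalForm I I' F p x z) (J (F p) (mfderiv I I' F p y)) := by
  have hy := mdiffAlongAt_mfderiv_apply hF (mdifferentiableAt_extend y)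
  have hz := mdiffAlongAt_mfderiv_apply hF (mdifferentiableAt_extend z)
  have hJz := (hJ.mdiffEndAt (F p)).apply_along hz
  have h1 := mvfderiv_inner_along (u := x) hy hJz
  simp only [hL.inner_eq_zero, mvfderiv_const, _root_.zero_apply] at h1
  rw [covAlong_apply (hJ.mdiffEndAt (F p)) hz, hJ.covEnd_eq_zero, zero_add,
    FiberBundle.extend_apply_self,
    FiberBundle.extend_apply_self] at h1
  rw [secondFundamentalForm, secondFundamentalForm, inner_sub_left, inner_sub_left,
    hL.inner_eq_zero, hL.inner_eq_zero, sub_zero, sub_zero,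
    real_inner_comm (J (F p) (mfderiv I I' F p y)), hJ.inner_left]
  linarith

variable [I.Boundaryless] [I'.Boundaryless]

theorem inner_secondFundamentalForm_self_of_isClairautWith (hF : ContMDiff I I' ∞ F)
    (hg : ContMDiff I' 𝓘(ℝ, ℝ) ∞ g) (hC : IsClairautWith I I' F (fun y ↦ Real.exp (g y)))
    (x : TangentSpace I p) {V : TangentSpace I' (F p)} (hV : V ∈ (rangeD I I' F p)ᗮ) :
    inner ℝ (secondFundamentalForm I I' F p x x) V
      = -(mvfderiv I' g (F p) V * inner ℝ (mfderiv I I' F p x) (mfderiv I I' F p x)) := by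
  obtain ⟨U, hU, hpU, W, hW, D, hD, hDF, hgeo⟩ := hC.2 p
  have hDp := (hDF p hpU).2
  have hP : MDiffEndAt I' (fun y ↦ (D y).starProjection) (F p) := hD.mdiffEndAt hW (hDF p hpU).1
  have hx := mdiffAlongAt_mfderiv_apply hF (mdifferentiableAt_extend x)
  have h1 := covAlong_apply (u := x) hP hx
  have h2 : ∀ᶠ q in 𝓝 p, (D (F q)).starProjection (mfderiv I I' F q (FiberBundle.extend E x q))
      = mfderiv I I' F q (FiberBundle.extend E x q) := by
    filter_upwards [hU.mem_nhds hpU] with q hq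
    rw [Submodule.starProjection_eq_self_iff, (hDF q hq).2]
    exact mfderiv_mem_rangeD _
  rw [covAlong_congr h2, FiberBundle.extend_apply_self] at h1
  have hPV : ∀ w, inner ℝ ((D (F p)).starProjection w) V = 0 := fun w ↦
    hV _ (hDp ▸ Submodule.starProjection_apply_mem (D (F p)) w)
  rw [secondFundamentalForm, h1, inner_sub_left, inner_add_left,
    hV _ (mfderiv_mem_rangeD _), hPV,
    add_zero, sub_zero]
  exact inner_covEnd_of_clairaut hW hD (hDF p hpU).1 (hg.mdifferentiableAt (by simp)) hgeo
    (hDp ▸ mfderiv_mem_rangeD x) (hDp ▸ hV)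

theorem inner_secondFundamentalForm_of_isClairautWith (hF : ContMDiff I I' ∞ F)
    (hg : ContMDiff I' 𝓘(ℝ, ℝ) ∞ g) (hC : IsClairautWith I I' F (fun y ↦ Real.exp (g y)))
    (x y : TangentSpace I p) {V : TangentSpace I' (F p)} (hV : V ∈ (rangeD I I' F p)ᗮ) :
    inner ℝ (secondFundamentalForm I I' F p x y) V
      = -(mvfderiv I' g (F p) V * inner ℝ (mfderiv I I' F p x) (mfderiv I I' F p y)) := by
  have h := fun x ↦ inner_secondFundamentalForm_self_of_isClairautWith hF hg hC x hV
  have h1 := h (x + y)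
  rw [secondFundamentalForm_add_left hF, secondFundamentalForm_add_right hF,
    secondFundamentalForm_add_right hF, secondFundamentalForm_comm hF y x] at h1
  simp only [inner_add_left, map_add, inner_add_right, h] at h1
  rw [real_inner_comm (mfderiv I I' F p x) (mfderiv I I' F p y)] at h1
  linarith

theorem exists_ne_zero_inner_eq_zero {V : Type*} [NormedAddCommGroup V] [InnerProductSpace ℝ V]
    [FiniteDimensional ℝ V] (R : Submodule ℝ V) (hR : 1 < Module.finrank ℝ R) (z : V) :
    ∃ w ∈ R, w ≠ 0 ∧ inner ℝ z w = 0 := by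
  have h := LinearMap.ker_ne_bot_of_finrank_lt (f := (innerₗ V z).domRestrict R)
    (by rwa [Module.finrank_self])
  obtain ⟨w, hw, hw0⟩ := Submodule.exists_mem_ne_zero_of_ne_bot h
  exact ⟨w, w.2, by simpa using hw0, by simpa using hw⟩

theorem inner_secondFundamentalForm_eq_zero (hF : ContMDiff I I' ∞ F)
    (hJ : IsKahler I' J) (hL : IsLagrangian I I' F J)
    (hg : ContMDiff I' 𝓘(ℝ, ℝ) ∞ g) (hC : IsClairautWith I I' F (fun y ↦ Real.exp (g y)))
    (hrank : 1 < Module.finrank ℝ (rangeD I I' F p)) (x y z : TangentSpace I p) :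
    inner ℝ (secondFundamentalForm I I' F p x y) (J (F p) (mfderiv I I' F p z)) = 0 := by
  have hmem : ∀ z, J (F p) (mfderiv I I' F p z) ∈ (rangeD I I' F p)ᗮ := fun z ↦
    hL.antiInvariant p ⟨_, mfderiv_mem_rangeD z, rfl⟩
  rw [inner_secondFundamentalForm_of_isClairautWith hF hg hC x y (hmem z)]
  obtain ⟨_, ⟨w, rfl⟩, hw0, hw⟩ := exists_ne_zero_inner_eq_zero _ hrank (mfderiv I I' F p z)
  have h := inner_secondFundamentalForm_comm_of_isLagrangian hF hJ hL w w z
  rw [inner_secondFundamentalForm_of_isClairautWith hF hg hC _ _ (hmem _),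
    inner_secondFundamentalForm_of_isClairautWith hF hg hC _ _ (hmem _),
    real_inner_comm (mfderiv I I' F p z)] at h
  have h0 : inner ℝ (mfderiv I I' F p z) (mfderiv I I' F p w) = 0 := hw
  have hw0' : inner ℝ (mfderiv I I' F p w) (mfderiv I I' F p w) ≠ 0 := inner_self_ne_zero.2 hw0
  rw [h0, mul_zero, neg_inj] at h
  rw [(mul_eq_zero.1 h).resolve_right hw0', zero_mul, neg_zero]

theorem secondFundamentalForm_mem_rangeD (hF : ContMDiff I I' ∞ F)
    (hJ : IsKahler I' J) (hL : IsLagrangian I I' F J)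
    (hg : ContMDiff I' 𝓘(ℝ, ℝ) ∞ g) (hC : IsClairautWith I I' F (fun y ↦ Real.exp (g y)))
    (hrank : 1 < Module.finrank ℝ (rangeD I I' F p)) (x y : TangentSpace I p) :
    secondFundamentalForm I I' F p x y ∈ rangeD I I' F p := by
  set s := secondFundamentalForm I I' F p x y
  set R := rangeD I I' F p
  have h : s - R.starProjection s ∈ Rᗮ ⊓ (R.map (J (F p)).toLinearMap)ᗮ := by
    refine ⟨Submodule.sub_starProjection_mem_orthogonal s, ?_⟩
    rintro _ ⟨_, ⟨z, rfl⟩, rfl⟩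
    change inner ℝ (J (F p) (mfderiv I I' F p z)) _ = 0
    rw [real_inner_comm, inner_sub_left,
      inner_secondFundamentalForm_eq_zero hF hJ hL hg hC hrank, zero_sub, neg_eq_zero]
    exact hL.antiInvariant p ⟨_, mfderiv_mem_rangeD z, rfl⟩ _ (Submodule.starProjection_apply_mem _ _)
  rw [hL.mu_eq_bot p, Submodule.mem_bot, sub_eq_zero] at h
  rw [h]
  exact Submodule.starProjection_apply_mem _ _

end Maps

section Trace

variable {V : Type*} [NormedAddCommGroup V] [InnerProductSpace ℝ V]
  {A : Type*} [AddCommGroup A] [Module ℝ A] {ι κ : Type*} [Fintype ι] [Fintype κ]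

theorem sum_starProjection_left (e : OrthonormalBasis ι ℝ V) {K : Submodule ℝ V}
    [K.HasOrthogonalProjection] (f : OrthonormalBasis κ ℝ K) (B : V →ₗ[ℝ] V →ₗ[ℝ] A) :
    ∑ i, B (K.starProjection (e i)) (e i) = ∑ k, B (f k) (f k) := by
  have h1 : ∀ v, K.starProjection v = ∑ k, inner ℝ (f k : V) v • (f k : V) := fun v ↦ by
    rw [Submodule.starProjection_apply, ← f.sum_repr' (K.orthogonalProjectionOnto v)]
    simp
  simp only [h1, map_sum, LinearMap.sum_apply, map_smul, LinearMap.smul_apply]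
  rw [Finset.sum_comm]
  refine Finset.sum_congr rfl fun k _ ↦ ?_
  simp only [← map_smul, ← map_sum]
  congr 1
  conv_rhs => rw [← e.sum_repr' (f k : V)]
  exact Finset.sum_congr rfl fun i _ ↦ by rw [real_inner_comm]

/-- If a bilinear map vanishes on `Kᗮ`, its trace is the trace of its restriction to `K`. -/
theorem sum_eq_sum_of_orthogonal (e : OrthonormalBasis ι ℝ V) {K : Submodule ℝ V}
    [K.HasOrthogonalProjection] (f : OrthonormalBasis κ ℝ K) (B : V →ₗ[ℝ] V →ₗ[ℝ] A)
    (hB : ∀ v ∈ Kᗮ, B v v = 0) : ∑ i, B (e i) (e i) = ∑ k, B (f k) (f k) := by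
  have h1 := sum_starProjection_left e f B
  have h2 := sum_starProjection_left e f B.flip
  have h3 := sum_starProjection_left e f (B.compl₂ K.starProjection.toLinearMap)
  simp only [LinearMap.flip_apply, LinearMap.compl₂_apply, ContinuousLinearMap.coe_coe] at h2 h3
  have h4 : ∀ i, B (e i) (e i) = B (K.starProjection (e i)) (e i) + B (e i) (K.starProjection (e i))
      - B (K.starProjection (e i)) (K.starProjection (e i)) := fun i ↦ by
    have := hB _ (K.sub_starProjection_mem_orthogonal (e i))
    simp only [map_sub, LinearMap.sub_apply] at this
    rw [← sub_eq_zero, ← this]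
    abel
  have h5 : ∀ k, K.starProjection (f k : V) = f k := fun k ↦
    Submodule.starProjection_eq_self_iff.2 (f k).2
  simp only [h5] at h3
  rw [Finset.sum_congr rfl fun i _ ↦ h4 i, Finset.sum_sub_distrib, Finset.sum_add_distrib, h1, h2,
    h3, add_sub_cancel_right]

end Trace

section Maps

variable {E : Type*} [NormedAddCommGroup E] [NormedSpace ℝ E] [FiniteDimensional ℝ E]
  {H : Type*} [TopologicalSpace H] {I : ModelWithCorners ℝ E H}
  {M : Type*} [TopologicalSpace M] [ChartedSpace H M] [IsManifold I ∞ M]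
  [RiemannianBundle (fun x : M ↦ TangentSpace I x)]
  [IsContMDiffRiemannianBundle I ∞ E (fun x : M ↦ TangentSpace I x)]
  {E' : Type*} [NormedAddCommGroup E'] [NormedSpace ℝ E'] [FiniteDimensional ℝ E']
  {H' : Type*} [TopologicalSpace H'] {I' : ModelWithCorners ℝ E' H'}
  {N : Type*} [TopologicalSpace N] [ChartedSpace H' N] [IsManifold I' ∞ N]
  [RiemannianBundle (fun x : N ↦ TangentSpace I' x)]
  [IsContMDiffRiemannianBundle I' ∞ E' (fun x : N ↦ TangentSpace I' x)]
  {F : M → N} {p : M}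

theorem mfderiv_kerD_starProjection (v : TangentSpace I p) :
    mfderiv I I' F p ((kerD I I' F p).starProjection v) = 0 :=
  Submodule.starProjection_apply_mem (kerD I I' F p) v

theorem mfderiv_kerD_orthogonal_starProjection (v : TangentSpace I p) :
    mfderiv I I' F p ((kerD I I' F p)ᗮ.starProjection v) = mfderiv I I' F p v := by
  rw [Submodule.starProjection_orthogonal_val, map_sub, mfderiv_kerD_starProjection, sub_zero]

theorem IsRiemannianMap.inner_mfderiv (hF : IsRiemannianMap I I' F) (v : TangentSpace I p)
    {w : TangentSpace I p} (hw : w ∈ (kerD I I' F p)ᗮ) :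
    inner ℝ (mfderiv I I' F p v) (mfderiv I I' F p w) = inner ℝ v w := by
  rw [← mfderiv_kerD_orthogonal_starProjection v,
    hF.isometry p _ (Submodule.starProjection_apply_mem _ _) w hw,
    Submodule.inner_starProjection_left_eq_right, Submodule.starProjection_eq_self_iff.2 hw]

theorem IsRiemannianMap.contMDiffAt_horizontal (hF : IsRiemannianMap I I' F)
    {Y : Π q : M, TangentSpace I q} (hY : CMDiffAt ∞ (T% Y) p) :
    CMDiffAt ∞ (T% (fun q ↦ (kerD I I' F q)ᗮ.starProjection (Y q))) p := by
  refine contMDiffAt_of_inner fun Z hZ ↦ ?_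
  have h : ∀ q, inner ℝ ((kerD I I' F q)ᗮ.starProjection (Y q)) (Z q)
      = inner ℝ (mfderiv I I' F q (Y q)) (mfderiv I I' F q (Z q)) := fun q ↦ by
    rw [real_inner_comm, real_inner_comm (mfderiv I I' F q (Z q)),
      ← hF.inner_mfderiv (Z q) (Submodule.starProjection_apply_mem _ _),
      mfderiv_kerD_orthogonal_starProjection]
  simp only [h]
  exact ContMDiffAt.inner_bundle (contMDiffAt_mfderiv_apply hF.smooth hY)
    (contMDiffAt_mfderiv_apply hF.smooth hZ)

theorem IsRiemannianMap.mdifferentiableAt_horizontal (hF : IsRiemannianMap I I' F)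
    (v : TangentSpace I p) :
    MDiffAt (T% (fun q ↦ (kerD I I' F q)ᗮ.starProjection (FiberBundle.extend E v q))) p :=
  (hF.contMDiffAt_horizontal (contMDiffAt_extend v)).mdifferentiableAt (by simp)

theorem IsRiemannianMap.mdifferentiableAt_vertical (hF : IsRiemannianMap I I' F)
    (v : TangentSpace I p) :
    MDiffAt (T% (fun q ↦ (kerD I I' F q).starProjection (FiberBundle.extend E v q))) p := by
  have h := mdifferentiableAt_sub_section (mdifferentiableAt_extend v)
    (hF.mdifferentiableAt_horizontal v)
  convert h using 3 with q
  simp [Submodule.starProjection_orthogonal_val]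

theorem IsRiemannianMap.inner_secondFundamentalForm_swap (hF : IsRiemannianMap I I' F)
    (x : TangentSpace I p) {y z : TangentSpace I p} (hy : y ∈ (kerD I I' F p)ᗮ)
    (hz : z ∈ (kerD I I' F p)ᗮ) :
    inner ℝ (secondFundamentalForm I I' F p x y) (mfderiv I I' F p z)
      + inner ℝ (secondFundamentalForm I I' F p x z) (mfderiv I I' F p y) = 0 := by
  have hY := hF.mdifferentiableAt_horizontal y
  have hZ := hF.mdifferentiableAt_horizontal z
  have e1 := mvfderiv_inner_along (u := x) (mdiffAlongAt_mfderiv_apply hF.smooth hY)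
    (mdiffAlongAt_mfderiv_apply hF.smooth hZ)
  have e2 := mvfderiv_inner hY hZ x
  have e3 := secondFundamentalForm_eq hF.smooth hY x
  have e4 := secondFundamentalForm_eq hF.smooth hZ x
  have hyp : (kerD I I' F p)ᗮ.starProjection (FiberBundle.extend E y p) = y := by
    rw [FiberBundle.extend_apply_self, Submodule.starProjection_eq_self_iff.2 hy]
  have hzp : (kerD I I' F p)ᗮ.starProjection (FiberBundle.extend E z p) = z := by
    rw [FiberBundle.extend_apply_self, Submodule.starProjection_eq_self_iff.2 hz]
  simp only [hF.inner_mfderiv _ (Submodule.starProjection_apply_mem _ _)] at e1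
  simp only [hyp, hzp] at e1 e2 e3 e4
  rw [e2] at e1
  rw [e3, e4, inner_sub_left, inner_sub_left, hF.inner_mfderiv _ hz, hF.inner_mfderiv _ hy]
  rw [real_inner_comm _ (mfderiv I I' F p y), real_inner_comm _ y] at e1
  linarith

theorem IsRiemannianMap.distributionSFF_eq (hF : IsRiemannianMap I I' F) (u : TangentSpace I p)
    {v : TangentSpace I p} (hv : v ∈ kerD I I' F p) :
    mfderiv I I' F p (distributionSFF I (kerD I I' F) p u v)
      = -secondFundamentalForm I I' F p u v := by
  have h := secondFundamentalForm_eq hF.smooth (hF.mdifferentiableAt_vertical v) u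
  have hp : (kerD I I' F p).starProjection (FiberBundle.extend E v p) = v := by
    rw [FiberBundle.extend_apply_self, Submodule.starProjection_eq_self_iff.2 hv]
  have h0 := covAlong_comp (I := I') (I' := I) (u := u) (p := p)
    (hF.smooth.mdifferentiable (by simp) p) (Y := (0 : Π x : N, TangentSpace I' x))
    (mdifferentiableAt_zeroSection ..)
  rw [leviCivita_zero] at h0
  simp only [hp, mfderiv_kerD_starProjection] at h
  rw [distributionSFF, mfderiv_kerD_orthogonal_starProjection, h, neg_sub]
  exact (sub_eq_self.2 h0).symm

theorem finrank_smul_meanCurvature (D : Π y : M, Submodule ℝ (TangentSpace I y)) :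
    (Module.finrank ℝ (D p) : ℝ) • meanCurvature I D p = ∑ i, distributionSFF I D p
      (stdOrthonormalBasis ℝ (D p) i) (stdOrthonormalBasis ℝ (D p) i) := by
  rw [meanCurvature]
  by_cases h : Module.finrank ℝ (D p) = 0
  · have : IsEmpty (Fin (Module.finrank ℝ (D p))) := by rw [h]; infer_instance
    simp
  · rw [smul_inv_smul₀ (by exact_mod_cast h)]

theorem meanCurvature_mem (D : Π y : M, Submodule ℝ (TangentSpace I y)) :
    meanCurvature I D p ∈ (D p)ᗮ :=
  Submodule.smul_mem _ _ (Submodule.sum_mem _ fun _ _ ↦ Submodule.starProjection_apply_mem _ _)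

theorem finrank_smul_meanCurvature_eq_zero_iff (D : Π y : M, Submodule ℝ (TangentSpace I y)) :
    (Module.finrank ℝ (D p) : ℝ) • meanCurvature I D p = 0 ↔ meanCurvature I D p = 0 := by
  refine ⟨fun h ↦ ?_, fun h ↦ by rw [h, smul_zero]⟩
  rw [finrank_smul_meanCurvature] at h
  rw [meanCurvature, h, smul_zero]

/-- A parallel mean curvature vector field of `ker F_*` vanishes. -/
theorem IsRiemannianMap.meanCurvature_eq_zero_of_isParallel (hF : IsRiemannianMap I I' F)
    (h : IsParallel I (meanCurvature I (kerD I I' F))) :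
    meanCurvature I (kerD I I' F) p = 0 := by
  rw [← finrank_smul_meanCurvature_eq_zero_iff, ← inner_self_eq_zero (𝕜 := ℝ),
    real_inner_smul_left, mul_eq_zero]
  right
  set η := meanCurvature I (kerD I I' F)
  have hη : MDiffAt (T% η) p := ContMDiffAt.mdifferentiableAt (h.1 p) (by simp)
  rw [finrank_smul_meanCurvature, inner_sum]
  refine Finset.sum_eq_zero fun i _ ↦ ?_
  set v := stdOrthonormalBasis ℝ (kerD I I' F p) i
  have e1 := mvfderiv_inner hη (hF.mdifferentiableAt_vertical v) v
  have h0 : ∀ q, inner ℝ (η q) ((kerD I I' F q).starProjection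
      (FiberBundle.extend E (v : TangentSpace I p) q)) = 0 := fun q ↦
    Submodule.inner_left_of_mem_orthogonal (Submodule.starProjection_apply_mem _ _)
      (meanCurvature_mem _)
  simp only [h0, mvfderiv_const, _root_.zero_apply, h.2, inner_zero_left, zero_add] at e1
  rw [distributionSFF, ← Submodule.inner_starProjection_left_eq_right,
    Submodule.starProjection_eq_self_iff.2 (meanCurvature_mem _), ← e1]

variable [I.Boundaryless] [I'.Boundaryless]

variable {J : Π y : N, TangentSpace I' y →L[ℝ] TangentSpace I' y} {g : N → ℝ}

theorem IsRiemannianMap.secondFundamentalForm_horizontal (hF : IsRiemannianMap I I' F)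
    (hJ : IsKahler I' J) (hL : IsLagrangian I I' F J)
    (hg : ContMDiff I' 𝓘(ℝ, ℝ) ∞ g) (hC : IsClairautWith I I' F (fun y ↦ Real.exp (g y)))
    (hrank : 1 < Module.finrank ℝ (rangeD I I' F p)) {x y : TangentSpace I p}
    (hx : x ∈ (kerD I I' F p)ᗮ) (hy : y ∈ (kerD I I' F p)ᗮ) :
    secondFundamentalForm I I' F p x y = 0 := by
  have h0 : ∀ z ∈ (kerD I I' F p)ᗮ,
      inner ℝ (secondFundamentalForm I I' F p x y) (mfderiv I I' F p z) = 0 := by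
    intro z hz
    have h1 := hF.inner_secondFundamentalForm_swap x hy hz
    have h2 := hF.inner_secondFundamentalForm_swap y hx hz
    have h3 := hF.inner_secondFundamentalForm_swap z hx hy
    rw [secondFundamentalForm_comm hF.smooth y x] at h2
    rw [secondFundamentalForm_comm hF.smooth z x, secondFundamentalForm_comm hF.smooth z y] at h3
    linarith
  obtain ⟨z, hz⟩ := secondFundamentalForm_mem_rangeD hF.smooth hJ hL hg hC hrank x y
  have hz' : mfderiv I I' F p ((kerD I I' F p)ᗮ.starProjection z)
      = secondFundamentalForm I I' F p x y := by
    rw [mfderiv_kerD_orthogonal_starProjection]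
    exact hz
  have h := h0 _ (Submodule.starProjection_apply_mem _ z)
  rwa [hz', inner_self_eq_zero] at h

theorem IsRiemannianMap.tensionField_eq (hF : IsRiemannianMap I I' F)
    (hJ : IsKahler I' J) (hL : IsLagrangian I I' F J)
    (hg : ContMDiff I' 𝓘(ℝ, ℝ) ∞ g) (hC : IsClairautWith I I' F (fun y ↦ Real.exp (g y)))
    (hrank : 1 < Module.finrank ℝ (rangeD I I' F p)) :
    tensionField I I' F p = -mfderiv I I' F p
      ((Module.finrank ℝ (kerD I I' F p) : ℝ) • meanCurvature I (kerD I I' F) p) := by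
  let B : TangentSpace I p →ₗ[ℝ] TangentSpace I p →ₗ[ℝ] TangentSpace I' (F p) :=
    LinearMap.mk₂ ℝ (secondFundamentalForm I I' F p)
      (secondFundamentalForm_add_left hF.smooth) (secondFundamentalForm_smul_left hF.smooth)
      (secondFundamentalForm_add_right hF.smooth) (secondFundamentalForm_smul_right hF.smooth)
  have h := sum_eq_sum_of_orthogonal (stdOrthonormalBasis ℝ (TangentSpace I p))
    (stdOrthonormalBasis ℝ (kerD I I' F p)) B fun v hv ↦
      hF.secondFundamentalForm_horizontal hJ hL hg hC hrank hv hv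
  rw [finrank_smul_meanCurvature, map_sum, ← Finset.sum_neg_distrib]
  refine h.trans (Finset.sum_congr rfl fun i _ ↦ ?_)
  rw [hF.distributionSFF_eq _ (Subtype.prop _), neg_neg]
  rfl

theorem IsRiemannianMap.isHarmonic_iff_isParallel_meanCurvature (hF : IsRiemannianMap I I' F)
    (hJ : IsKahler I' J) (hL : IsLagrangian I I' F J)
    (hg : ContMDiff I' 𝓘(ℝ, ℝ) ∞ g) (hC : IsClairautWith I I' F (fun y ↦ Real.exp (g y)))
    (hrank : ∀ p, 1 < Module.finrank ℝ (rangeD I I' F p)) :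
    IsHarmonic I I' F ↔ IsParallel I (meanCurvature I (kerD I I' F)) := by
  have hτ : ∀ p, tensionField I I' F p = 0 ↔ meanCurvature I (kerD I I' F) p = 0 := by
    intro p
    rw [hF.tensionField_eq hJ hL hg hC (hrank p), neg_eq_zero,
      ← finrank_smul_meanCurvature_eq_zero_iff]
    set η := (Module.finrank ℝ (kerD I I' F p) : ℝ) • meanCurvature I (kerD I I' F) p
    have hη : η ∈ (kerD I I' F p)ᗮ := Submodule.smul_mem _ _ (meanCurvature_mem _)
    refine ⟨fun h ↦ ?_, fun h ↦ by rw [h, map_zero]⟩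
    rw [← inner_self_eq_zero (𝕜 := ℝ), ← hF.inner_mfderiv η hη, h, inner_zero_left]
  constructor
  · intro h
    have h0 : meanCurvature I (kerD I I' F) = (0 : Π x : M, TangentSpace I x) :=
      funext fun p ↦ (hτ p).1 (h.2 p)
    rw [h0]
    exact ⟨fun x ↦ contMDiff_zeroSection ℝ (TangentSpace I : M → Type _) x,
      fun x v ↦ leviCivita_zero v⟩
  · exact fun h ↦ ⟨hF.smooth, fun p ↦ (hτ p).2 (hF.meanCurvature_eq_zero_of_isParallel h)⟩

end Maps

end RiemannianMap

theorem mainTheorem12 {m n : ℕ}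
    {M : Type*} [TopologicalSpace M] [T2Space M] [SecondCountableTopology M]
    [ChartedSpace (EuclideanSpace ℝ (Fin m)) M] [IsManifold (𝓡 m) ∞ M]
    [RiemannianBundle (fun x : M ↦ TangentSpace (𝓡 m) x)]
    [IsContMDiffRiemannianBundle (𝓡 m) ∞ (EuclideanSpace ℝ (Fin m))
      (fun x : M ↦ TangentSpace (𝓡 m) x)]
    {N : Type*} [TopologicalSpace N] [T2Space N] [SecondCountableTopology N]
    [ChartedSpace (EuclideanSpace ℝ (Fin n)) N] [IsManifold (𝓡 n) ∞ N]
    [RiemannianBundle (fun y : N ↦ TangentSpace (𝓡 n) y)]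
    [IsContMDiffRiemannianBundle (𝓡 n) ∞ (EuclideanSpace ℝ (Fin n))
      (fun y : N ↦ TangentSpace (𝓡 n) y)]
    (J : Π y : N, TangentSpace (𝓡 n) y →L[ℝ] TangentSpace (𝓡 n) y)
    (hJ : RiemannianMap.IsKahler (𝓡 n) J)
    (F : M → N) (hF : RiemannianMap.IsRiemannianMap (𝓡 m) (𝓡 n) F)
    (hL : RiemannianMap.IsLagrangian (𝓡 m) (𝓡 n) F J)
    (g : N → ℝ) (hg : ContMDiff (𝓡 n) 𝓘(ℝ, ℝ) ∞ g)
    (hC : RiemannianMap.IsClairautWith (𝓡 m) (𝓡 n) F (fun y ↦ Real.exp (g y)))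
    (hrank : ∀ p, 1 < Module.finrank ℝ (RiemannianMap.rangeD (𝓡 m) (𝓡 n) F p)) :
    RiemannianMap.IsHarmonic (𝓡 m) (𝓡 n) F ↔
      RiemannianMap.IsParallel (𝓡 m)
        (RiemannianMap.meanCurvature (𝓡 m) (RiemannianMap.kerD (𝓡 m) (𝓡 n) F)) :=
  hF.isHarmonic_iff_isParallel_meanCurvature hJ hL hg hC hrank
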